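/- Let $d,k\ge 0$ be integers and let $\varphi:\mathbb{Z}^k\hookrightarrow \mathrm{SL}_d(\mathbb{Z})$ be an injective homomorphism whose image is contained in an $\mathbb{R}$-split torus $T\subset \mathrm{SL}_d(\mathbb{R})$ (so the matrices $\varphi(y)$, $y\in\mathbb{Z}^k$, are simultaneously diagonalisable over $\mathbb{R}$). Let $\Gamma=\mathbb{Z}^d\rtimes_\varphi\mathbb{Z}^k$, with multiplication $(x,y)(x',y')=(x+\varphi(y)x',\,y+y')$, and let $|\cdot|$ denote the word length on $\Gamma$ with respect to a finite generating set $X$. Let $$\mathrm{CLF}_\Gamma(n)=\max\bigl\{\min\{|w| : w\in\Gamma,\ wu=vw\}\ :\ u,v\in\Gamma \text{ conjugate in } \Gamma,\ |u|+|v|\le n\bigr\}\qquad(n\in\mathbb{N})$$ be the conjugacy length function of $\Gamma$. Then there exist constants $A>1$ and $B>0$, depending only on $\Gamma$ and $X$, such that 1. if $k=1$, then $\mathrm{CLF}_\Gamma(n)\le Bn$ for all $n\in\mathbb{N}$; 2. if $k>1$, then $\mathrm{CLF}_\Gamma(n)\le A^n$ for all $n\in\mathbb{N}$. -/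

import Mathlib

open scoped MatrixGroups

noncomputable section

/-- `IsWordIn X l`: the list `l` is a word in the letters `X ∪ X⁻¹`. -/
def IsWordIn {G : Type*} [Group G] (X : Set G) (l : List G) : Prop :=
  ∀ x ∈ l, x ∈ X ∨ x⁻¹ ∈ X

/-- The word length of `g` with respect to `X`: the length of a shortest word in `X ∪ X⁻¹` that
represents `g` (meaningful when `X` generates `G`). -/
def wordLength {G : Type*} [Group G] (X : Set G) (g : G) : ℕ :=
  sInf {m : ℕ | ∃ l : List G, IsWordIn X l ∧ l.prod = g ∧ l.length = m}

/-- The length of a shortest conjugator: `min {|w| : w u = v w}` (meaningful when `u`, `v` are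
conjugate). -/
def conjugatorLength {G : Type*} [Group G] (X : Set G) (u v : G) : ℕ :=
  sInf {m : ℕ | ∃ w : G, w * u = v * w ∧ wordLength X w = m}

/-- The shortest-conjugator lengths of conjugate pairs `u`, `v` with `|u| + |v| ≤ n`. -/
def conjugatorLengths {G : Type*} [Group G] (X : Set G) (n : ℕ) : Set ℕ :=
  {m : ℕ | ∃ u v : G, wordLength X u + wordLength X v ≤ n ∧ IsConj u v ∧
    conjugatorLength X u v = m}

/-- The conjugacy length function of `G` with respect to `X`:
`n ↦ max {min {|w| : w u = v w} : |u| + |v| ≤ n, u conjugate to v}`.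
For a finite generating set the supremum is a maximum, see `isGreatest_conjugacyLength`. -/
def conjugacyLength {G : Type*} [Group G] (X : Set G) (n : ℕ) : ℕ :=
  sSup (conjugatorLengths X n)

theorem exists_word {G : Type*} [Group G] {X : Set G} (hX : Subgroup.closure X = ⊤) (g : G) :
    ∃ l : List G, IsWordIn X l ∧ l.prod = g := by
  have hg : g ∈ Submonoid.closure (X ∪ X⁻¹) := by
    rw [← Subgroup.closure_toSubmonoid, hX]; trivial
  exact Submonoid.exists_list_of_mem_closure hg

theorem wordLength_spec {G : Type*} [Group G] {X : Set G} (hX : Subgroup.closure X = ⊤) (g : G) :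
    ∃ l : List G, IsWordIn X l ∧ l.prod = g ∧ l.length = wordLength X g := by
  obtain ⟨l, h1, h2⟩ := exists_word hX g
  exact Nat.sInf_mem (s := {m : ℕ | ∃ l : List G, IsWordIn X l ∧ l.prod = g ∧ l.length = m})
    ⟨l.length, l, h1, h2, rfl⟩

theorem finite_wordLength_le {G : Type*} [Group G] {X : Set G} (hfin : X.Finite)
    (hX : Subgroup.closure X = ⊤) (n : ℕ) : {g : G | wordLength X g ≤ n}.Finite := by
  have hY : (X ∪ X⁻¹).Finite := hfin.union hfin.inv
  have : Finite ↥(X ∪ X⁻¹) := hY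
  refine ((List.finite_length_le ↥(X ∪ X⁻¹) n).image
    (fun l => (l.map Subtype.val).prod)).subset ?_
  intro g hg
  obtain ⟨l, h1, h2, h3⟩ := wordLength_spec hX g
  refine ⟨l.attach.map (fun x => ⟨x.1, h1 x.1 x.2⟩), ?_, ?_⟩
  · simpa [h3] using hg
  · simp [List.map_map, Function.comp_def, h2]

/-- For a finite generating set, the conjugacy length function is an honest maximum. -/
theorem isGreatest_conjugacyLength {G : Type*} [Group G] {X : Set G} (hfin : X.Finite)
    (hX : Subgroup.closure X = ⊤) (n : ℕ) :
    IsGreatest (conjugatorLengths X n) (conjugacyLength X n) := by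
  have hB := finite_wordLength_le hfin hX n
  have hf : (conjugatorLengths X n).Finite := by
    refine ((hB.prod hB).image (fun p => conjugatorLength X p.1 p.2)).subset ?_
    rintro m ⟨u, v, h, -, rfl⟩
    exact ⟨(u, v), ⟨le_trans (Nat.le_add_right _ _) h, le_trans (Nat.le_add_left _ _) h⟩, rfl⟩
  have h1 : wordLength X (1 : G) = 0 :=
    Nat.sInf_eq_zero.2 (Or.inl ⟨[], by simp [IsWordIn], rfl, rfl⟩)
  have hne : (conjugatorLengths X n).Nonempty :=
    ⟨_, 1, 1, by simp [h1], IsConj.refl 1, rfl⟩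
  exact ⟨Nat.sSup_mem hne hf.bddAbove, fun m hm => le_csSup hf.bddAbove hm⟩

/-- `SL_d(ℤ)` acting on the (multiplicatively written) group `ℤ^d` by matrix-vector
multiplication. -/
def slAction (d : ℕ) : SL(d, ℤ) →* MulAut (Multiplicative (Fin d → ℤ)) where
  toFun g := AddEquiv.toMultiplicative (Matrix.SpecialLinearGroup.toLin' g).toAddEquiv
  map_one' := by ext x; simp
  map_mul' g h := by ext x; simp

theorem slAction_apply (d : ℕ) (g : SL(d, ℤ)) (x : Fin d → ℤ) :
    slAction d g (Multiplicative.ofAdd x) =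
      Multiplicative.ofAdd ((g : Matrix (Fin d) (Fin d) ℤ).mulVec x) := rfl

/-- The semidirect product `ℤ^d ⋊_φ ℤ^k`, with `(x, y) (x', y') = (x + φ(y) x', y + y')`. -/
abbrev LatticeSemidirect {d k : ℕ} (φ : Multiplicative (Fin k → ℤ) →* SL(d, ℤ)) : Type :=
  Multiplicative (Fin d → ℤ) ⋊[(slAction d).comp φ] Multiplicative (Fin k → ℤ)

/-- `T` is (the group of real points of) an `ℝ`-split torus in `SL_d`: the image of a closed
embedding `𝔾_m^r → SL_d` of algebraic groups over `ℝ`. In a suitable basis (the columns of `P`)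
such an embedding is `t ↦ diag (t^{χ 1}, …, t^{χ d})` for characters `χ i` in `ℤ^r`, where
`t^χ = ∏ j, t_j ^ χ_j`; it is an embedding exactly if the `χ i` generate the character group
`ℤ^r`, and it has values in `SL_d` exactly if the `χ i` add up to zero. -/
def IsRealSplitTorus {d : ℕ} (T : Subgroup SL(d, ℝ)) : Prop :=
  ∃ (r : ℕ) (P : GL (Fin d) ℝ) (χ : Fin d → Fin r → ℤ),
    AddSubgroup.closure (Set.range χ) = ⊤ ∧ ∑ i, χ i = 0 ∧
    ∀ g : SL(d, ℝ), g ∈ T ↔ ∃ t : Fin r → ℝˣ,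
      (g : Matrix (Fin d) (Fin d) ℝ) =
        (P : Matrix (Fin d) (Fin d) ℝ) *
          Matrix.diagonal (fun i => ((∏ j, t j ^ χ i j : ℝˣ) : ℝ)) *
          ((P⁻¹ : GL (Fin d) ℝ) : Matrix (Fin d) (Fin d) ℝ)

end

/-! Write `u = (x, y)` and `v = (x', y)`. An element `(h, m)` conjugates `u` to `v` exactly if `(1 -
φ(y)) h = x' - φ(m) x`, and in eigen-coordinates this decouples into `(1 - λ_i(y)) h_i = x'_i -
λ_i(m) x_i`.

Given `m`, a short `h` exists (`exists_conjugatorLength_le`). If `λ_i(y) = 1`, subtracting a lattice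
vector fixed by `φ(y)` makes `h_i` bounded. Otherwise use that the product of the nonzero `1 -
λ_i(y)` is a nonzero integer up to sign: no factor is smaller than `exp (-K (|y| + 1))`, so `h_i` is
at most exponential in `|u| + |v| + |m|`. Where `|λ_i|` is not identically `1`, the eigendirection
is exponentially distorted and such an `h_i` costs only linear length; where `|λ_i|` is identically
`1`, `λ_i = ±1` and all estimates are linear. Hence the conjugator length is linear in `1 + |u| +
|v| + |m|`.

It remains to bound `m`. For `k = 1` the bound is linear (`exists_conj_latticeNorm_le_of_fin_one`):
if `y ≠ 0`, a power of `u` reduces `m` modulo `y`; if `y = 0`, a nonzero integer vector halfway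
along the orbit from `x` to `x'` cannot be small in every coordinate, unless only the parity of `m`
matters. For general `k` the bound is exponential (`exists_conj_latticeNorm_le_exp`): along the
segment from `0` to a shortest `m`, the orbit of `x` modulo the image of `1 - φ(y)` has
representatives in an exponentially large box, and a repetition would allow a piece of the segment
to be cut out. -/

open scoped MatrixGroups

noncomputable section

/-! ### Word length and conjugator length in a general group -/

section WordLength

variable {G : Type*} [Group G] {X : Set G}

theorem wordLength_le_length {l : List G} (h : IsWordIn X l) : wordLength X l.prod ≤ l.length :=
  Nat.sInf_le ⟨l, h, rfl, rfl⟩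

theorem wordLength_one : wordLength X (1 : G) = 0 := by
  have := wordLength_le_length (X := X) (l := []) (by simp [IsWordIn])
  simpa using this

theorem wordLength_mul_le (hX : Subgroup.closure X = ⊤) (g h : G) :
    wordLength X (g * h) ≤ wordLength X g + wordLength X h := by
  obtain ⟨l, h1, h2, h3⟩ := wordLength_spec hX g
  obtain ⟨l', h1', h2', h3'⟩ := wordLength_spec hX h
  have := wordLength_le_length (X := X) (l := l ++ l') (by
    intro x hx
    rcases List.mem_append.1 hx with hx | hx
    · exact h1 x hx
    · exact h1' x hx)
  rw [List.prod_append, List.length_append, h2, h2', h3, h3'] at this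
  exact this

theorem eq_one_of_wordLength_eq_zero (hX : Subgroup.closure X = ⊤) {g : G}
    (h : wordLength X g = 0) : g = 1 := by
  obtain ⟨l, -, h2, h3⟩ := wordLength_spec hX g
  rw [h, List.length_eq_zero_iff] at h3
  simpa [h3] using h2.symm

/-- A word is built by left multiplications, and the finitely many letters share one increment. This
is the source of every lower bound on word length below. -/
theorem exists_le_mul_wordLength (hfin : X.Finite) (hX : Subgroup.closure X = ⊤) (f : G → ℝ)
    (h1 : f 1 ≤ 0) (hf : ∀ s, ∃ C, ∀ g, f (s * g) ≤ C + f g) :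
    ∃ C, 0 ≤ C ∧ ∀ g, f g ≤ C * wordLength X g := by
  choose C hC using hf
  have hY : (X ∪ X⁻¹).Finite := hfin.union hfin.inv
  obtain ⟨B, hB⟩ := (hY.image C).bddAbove
  refine ⟨max B 0, le_max_right _ _, fun g => ?_⟩
  obtain ⟨l, hl, rfl, hlen⟩ := wordLength_spec hX g
  rw [← hlen]
  clear hlen
  induction l with
  | nil => simpa using h1
  | cons s l ih =>
    have h2 := ih (fun x hx => hl x (List.mem_cons_of_mem _ hx))
    have h3 : C s ≤ B := hB ⟨s, hl s List.mem_cons_self, rfl⟩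
    have h4 := hC s l.prod
    rw [List.prod_cons, List.length_cons]
    push_cast
    nlinarith [le_max_left B 0]

theorem conjugatorLength_le {u v w : G} (h : w * u = v * w) :
    conjugatorLength X u v ≤ wordLength X w :=
  Nat.sInf_le ⟨w, h, rfl⟩

theorem conjugatorLength_self (u : G) : conjugatorLength X u u = 0 := by
  have := conjugatorLength_le (X := X) (u := u) (v := u) (w := 1) (by simp)
  rw [wordLength_one] at this
  omega

/-- The bound `B * n` leaves no room for an additive constant, so `n = 0` is treated apart. -/
theorem conjugacyLength_zero (hfin : X.Finite) (hX : Subgroup.closure X = ⊤) :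
    conjugacyLength X 0 = 0 := by
  obtain ⟨⟨u, v, h, -, h'⟩, -⟩ := isGreatest_conjugacyLength hfin hX 0
  have hu := eq_one_of_wordLength_eq_zero hX (g := u) (by omega)
  have hv := eq_one_of_wordLength_eq_zero hX (g := v) (by omega)
  rw [← h', hu, hv, conjugatorLength_self]

end WordLength

/-! ### The norm on `ℤ^k` and bounds for subadditive functions -/

/-- The `ℓ¹`-norm on the (multiplicatively written) group `ℤ^k`. -/
def latticeNorm {k : ℕ} (y : Multiplicative (Fin k → ℤ)) : ℕ := ∑ j, (y.toAdd j).natAbs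

theorem exists_le_mul_latticeNorm {k : ℕ} (f : Multiplicative (Fin k → ℤ) → ℝ) (h1 : f 1 ≤ 0)
    (hf : ∀ y z, f (y * z) ≤ f y + f z) : ∃ C, 0 ≤ C ∧ ∀ y, f y ≤ C * latticeNorm y := by
  have hpow : ∀ y (n : ℕ), f (y ^ n) ≤ n * f y := by
    intro y n
    induction n with
    | zero => simpa using h1
    | succ n ih =>
      rw [pow_succ]
      push_cast
      linarith [hf (y ^ n) y]
  let e : Fin k → Multiplicative (Fin k → ℤ) := fun j => Multiplicative.ofAdd (Pi.single j 1)
  let B : Fin k → ℝ := fun j => max 0 (max (f (e j)) (f (e j)⁻¹))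
  have hB : ∀ j, 0 ≤ B j := fun j => le_max_left _ _
  have hz : ∀ j (n : ℤ), f (e j ^ n) ≤ B j * n.natAbs := by
    intro j n
    have ha : f (e j) ≤ B j := le_trans (le_max_left _ _) (le_max_right _ _)
    have hb : f (e j)⁻¹ ≤ B j := le_trans (le_max_right _ _) (le_max_right _ _)
    rcases Int.natAbs_eq n with h | h
    · rw [h, zpow_natCast, Int.natAbs_natCast, mul_comm]
      exact (hpow _ _).trans (by gcongr)
    · rw [h, zpow_neg, ← inv_zpow, zpow_natCast, Int.natAbs_neg, Int.natAbs_natCast, mul_comm]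
      exact (hpow _ _).trans (by gcongr)
  refine ⟨∑ j, B j, Finset.sum_nonneg fun j _ => hB j, fun y => ?_⟩
  have hy : y = ∏ j, e j ^ (y.toAdd j) := by
    apply Multiplicative.toAdd.injective
    rw [toAdd_prod]
    ext i
    simp [e, Finset.sum_apply, Pi.single_apply]
  have hs : ∀ s : Finset (Fin k), f (∏ j ∈ s, e j ^ (y.toAdd j)) ≤
      ∑ j ∈ s, B j * (y.toAdd j).natAbs := by
    intro s
    induction s using Finset.induction_on with
    | empty => simpa using h1
    | insert a s ha ih =>
      rw [Finset.prod_insert ha, Finset.sum_insert ha]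
      exact (hf _ _).trans (add_le_add (hz _ _) ih)
  calc f y = f (∏ j, e j ^ (y.toAdd j)) := by rw [← hy]
    _ ≤ ∑ j, B j * (y.toAdd j).natAbs := hs _
    _ ≤ ∑ j, B j * latticeNorm y := by
      refine Finset.sum_le_sum fun j _ => mul_le_mul_of_nonneg_left ?_ (hB j)
      exact_mod_cast Finset.single_le_sum (f := fun j => (y.toAdd j).natAbs)
        (fun _ _ => Nat.zero_le _) (Finset.mem_univ j)
    _ = _ := by rw [Finset.sum_mul]

theorem latticeNorm_mul_le {k : ℕ} (y z : Multiplicative (Fin k → ℤ)) :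
    latticeNorm (y * z) ≤ latticeNorm y + latticeNorm z := by
  unfold latticeNorm
  rw [← Finset.sum_add_distrib]
  exact Finset.sum_le_sum fun j _ => Int.natAbs_add_le _ _

theorem latticeNorm_one {k : ℕ} : latticeNorm (1 : Multiplicative (Fin k → ℤ)) = 0 := by
  simp [latticeNorm]

theorem Matrix.exists_abs_mulVec_le {d : ℕ} (A : Matrix (Fin d) (Fin d) ℝ) :
    ∃ C, 0 ≤ C ∧ ∀ (v : Fin d → ℝ) (R : ℝ), (∀ j, |v j| ≤ R) → ∀ i, |A.mulVec v i| ≤ C * R := by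
  refine ⟨∑ i, ∑ j, |A i j|, by positivity, fun v R h i => ?_⟩
  have hR : 0 ≤ R := (abs_nonneg _).trans (h i)
  calc |A.mulVec v i| ≤ ∑ j, |A i j * v j| :=
          Finset.abs_sum_le_sum_abs (fun j => A i j * v j) Finset.univ
    _ ≤ ∑ j, |A i j| * R := by
      gcongr with j
      rw [abs_mul]
      gcongr
      exact h j
    _ = (∑ j, |A i j|) * R := by rw [Finset.sum_mul]
    _ ≤ _ := by
      refine mul_le_mul_of_nonneg_right ?_ hR
      exact Finset.single_le_sum (f := fun i => ∑ j, |A i j|) (fun _ _ => by positivity)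
        (Finset.mem_univ i)

/-! ### Eigen-coordinates -/

/-- A simultaneous diagonalisation over `ℝ` of an action of `ℤ^k` on `ℤ^d`. -/
structure Diagonalization {d k : ℕ} (φ : Multiplicative (Fin k → ℤ) →* SL(d, ℤ)) where
  /-- The columns form the eigenbasis. -/
  P : GL (Fin d) ℝ
  /-- The eigenvalue characters. -/
  lam : Fin d → Multiplicative (Fin k → ℤ) →* ℝ
  spec : ∀ y, (φ y : Matrix (Fin d) (Fin d) ℤ).map (Int.cast : ℤ → ℝ) =
    (P : Matrix (Fin d) (Fin d) ℝ) * Matrix.diagonal (fun i => lam i y) *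
      ((P⁻¹ : GL (Fin d) ℝ) : Matrix (Fin d) (Fin d) ℝ)

theorem IsRealSplitTorus.nonempty_diagonalization {d k : ℕ}
    {φ : Multiplicative (Fin k → ℤ) →* SL(d, ℤ)} {T : Subgroup SL(d, ℝ)} (hT : IsRealSplitTorus T)
    (hφT : ∀ y, Matrix.SpecialLinearGroup.map (Int.castRingHom ℝ) (φ y) ∈ T) :
    Nonempty (Diagonalization φ) := by
  obtain ⟨r, P, χ, -, -, h⟩ := hT
  choose t ht using fun y => (h _).1 (hφT y)
  have hP1 : ((P⁻¹ : GL (Fin d) ℝ) : Matrix (Fin d) (Fin d) ℝ) *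
      (P : Matrix (Fin d) (Fin d) ℝ) = 1 := by
    rw [← Units.val_mul, inv_mul_cancel, Units.val_one]
  -- The characters are read off the conjugated matrices, which are multiplicative in `y` by
  -- construction; nothing need be known about how the chosen torus parameters `t y` depend on `y`.
  let ρ : Multiplicative (Fin k → ℤ) →* Matrix (Fin d) (Fin d) ℝ :=
    { toFun := fun y => ((P⁻¹ : GL (Fin d) ℝ) : Matrix (Fin d) (Fin d) ℝ) *
        (Matrix.SpecialLinearGroup.map (Int.castRingHom ℝ) (φ y) : Matrix (Fin d) (Fin d) ℝ) * P
      map_one' := by simp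
      map_mul' := fun y z => by
        have hP2 : (P : Matrix (Fin d) (Fin d) ℝ) *
            ((P⁻¹ : GL (Fin d) ℝ) : Matrix (Fin d) (Fin d) ℝ) = 1 := by
          rw [← Units.val_mul, mul_inv_cancel, Units.val_one]
        rw [map_mul, map_mul, Matrix.SpecialLinearGroup.coe_mul]
        simp only [Matrix.mul_assoc]
        rw [← Matrix.mul_assoc (P : Matrix (Fin d) (Fin d) ℝ), hP2, Matrix.one_mul] }
  have hρ : ∀ y, ρ y = Matrix.diagonal (fun i => ((∏ j, t y j ^ χ i j : ℝˣ) : ℝ)) := by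
    intro y
    change ((P⁻¹ : GL (Fin d) ℝ) : Matrix (Fin d) (Fin d) ℝ) *
        (Matrix.SpecialLinearGroup.map (Int.castRingHom ℝ) (φ y) : Matrix (Fin d) (Fin d) ℝ) *
        (P : Matrix (Fin d) (Fin d) ℝ) = _
    rw [ht]
    simp only [Matrix.mul_assoc]
    rw [hP1, Matrix.mul_one, ← Matrix.mul_assoc, hP1, Matrix.one_mul]
  refine ⟨⟨P, fun i => ⟨⟨fun y => ρ y i i, by simp⟩, fun y z => ?_⟩, fun y => ?_⟩⟩
  · change ρ (y * z) i i = ρ y i i * ρ z i i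
    rw [map_mul, hρ y, hρ z, Matrix.diagonal_mul_diagonal]
    simp
  · have h1 : (fun i => ρ y i i) = fun i => ((∏ j, t y j ^ χ i j : ℝˣ) : ℝ) := by
      ext i
      rw [hρ]
      simp
    change _ = _ * Matrix.diagonal (fun i => ρ y i i) * _
    rw [h1, ← ht]
    rfl

namespace Diagonalization

variable {d k : ℕ} {φ : Multiplicative (Fin k → ℤ) →* SL(d, ℤ)} (D : Diagonalization φ)

/-- The coordinates of an integer vector with respect to the eigenbasis. -/
def coord : (Fin d → ℤ) →+ (Fin d → ℝ) where
  toFun x := ((D.P⁻¹ : GL (Fin d) ℝ) : Matrix (Fin d) (Fin d) ℝ).mulVec (fun j => (x j : ℝ))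
  map_zero' := by
    ext i
    simp [Matrix.mulVec, dotProduct]
  map_add' x y := by
    rw [← Matrix.mulVec_add]
    congr 1
    ext j
    simp

theorem P_mul_inv : (D.P : Matrix (Fin d) (Fin d) ℝ) *
    ((D.P⁻¹ : GL (Fin d) ℝ) : Matrix (Fin d) (Fin d) ℝ) = 1 := by
  rw [← Units.val_mul, mul_inv_cancel, Units.val_one]

theorem inv_mul_P : ((D.P⁻¹ : GL (Fin d) ℝ) : Matrix (Fin d) (Fin d) ℝ) *
    (D.P : Matrix (Fin d) (Fin d) ℝ) = 1 := by
  rw [← Units.val_mul, inv_mul_cancel, Units.val_one]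

theorem P_mulVec_coord (x : Fin d → ℤ) :
    (D.P : Matrix (Fin d) (Fin d) ℝ).mulVec (D.coord x) = fun j => (x j : ℝ) := by
  change (D.P : Matrix (Fin d) (Fin d) ℝ).mulVec
    (((D.P⁻¹ : GL (Fin d) ℝ) : Matrix (Fin d) (Fin d) ℝ).mulVec _) = _
  rw [Matrix.mulVec_mulVec, P_mul_inv, Matrix.one_mulVec]

theorem coord_injective : Function.Injective D.coord := by
  intro x y h
  have := D.P_mulVec_coord x
  rw [h, P_mulVec_coord] at this
  ext j
  exact_mod_cast (congrFun this j).symm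

theorem coord_act (y : Multiplicative (Fin k → ℤ)) (x : Fin d → ℤ) (i : Fin d) :
    D.coord ((φ y : Matrix (Fin d) (Fin d) ℤ).mulVec x) i = D.lam i y * D.coord x i := by
  have h : (fun j => (((φ y : Matrix (Fin d) (Fin d) ℤ).mulVec x j : ℤ) : ℝ)) =
      ((φ y : Matrix (Fin d) (Fin d) ℤ).map (Int.cast : ℤ → ℝ)).mulVec (fun j => (x j : ℝ)) := by
    ext j
    simp [Matrix.mulVec, dotProduct]
  change (((D.P⁻¹ : GL (Fin d) ℝ) : Matrix (Fin d) (Fin d) ℝ).mulVec _) i = _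
  rw [h, D.spec, Matrix.mulVec_mulVec, ← Matrix.mul_assoc, ← Matrix.mul_assoc, inv_mul_P,
    Matrix.one_mul, ← Matrix.mulVec_mulVec, Matrix.mulVec_diagonal]
  rfl

theorem lam_ne_zero (i : Fin d) (y : Multiplicative (Fin k → ℤ)) : D.lam i y ≠ 0 := by
  intro h
  have : D.lam i (y * y⁻¹) = 0 := by rw [map_mul, h, zero_mul]
  simp at this

theorem exists_abs_coord_le :
    ∃ C, 0 ≤ C ∧ ∀ (x : Fin d → ℤ) (R : ℝ), (∀ j, |(x j : ℝ)| ≤ R) → ∀ i, |D.coord x i| ≤ C * R := by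
  obtain ⟨C, hC, h⟩ := Matrix.exists_abs_mulVec_le
    ((D.P⁻¹ : GL (Fin d) ℝ) : Matrix (Fin d) (Fin d) ℝ)
  exact ⟨C, hC, fun x R hx => h _ R hx⟩

theorem exists_abs_le_coord :
    ∃ C, 0 ≤ C ∧ ∀ (x : Fin d → ℤ) (R : ℝ), (∀ i, |D.coord x i| ≤ R) → ∀ j, |(x j : ℝ)| ≤ C * R := by
  obtain ⟨C, hC, h⟩ := Matrix.exists_abs_mulVec_le (D.P : Matrix (Fin d) (Fin d) ℝ)
  refine ⟨C, hC, fun x R hx j => ?_⟩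
  have := h _ R hx j
  rwa [P_mulVec_coord] at this

/-- Discreteness of the lattice: a nonzero integer vector has an entry of absolute value at least
`1`. -/
theorem exists_le_abs_coord :
    ∃ c, 0 < c ∧ ∀ x : Fin d → ℤ, x ≠ 0 → ∃ i, c ≤ |D.coord x i| := by
  obtain ⟨C, hC, h⟩ := D.exists_abs_le_coord
  refine ⟨1 / (C + 1), by positivity, fun x hx => ?_⟩
  by_contra! hlt
  apply hx
  ext j
  have h1 := h x _ (fun i => (hlt i).le) j
  have h2 : |(x j : ℝ)| < 1 := by
    refine h1.trans_lt ?_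
    rw [mul_one_div, div_lt_one (by positivity)]
    linarith
  rw [← Int.cast_abs] at h2
  have h3 : |x j| < 1 := by exact_mod_cast h2
  simpa using Int.abs_lt_one_iff.1 h3

theorem exists_round :
    ∃ R, 0 ≤ R ∧ ∀ v : Fin d → ℝ, ∃ x : Fin d → ℤ, ∀ i, |D.coord x i - v i| ≤ R := by
  obtain ⟨C, hC, h⟩ := Matrix.exists_abs_mulVec_le
    ((D.P⁻¹ : GL (Fin d) ℝ) : Matrix (Fin d) (Fin d) ℝ)
  refine ⟨C * 1, by positivity, fun v => ?_⟩
  let p := (D.P : Matrix (Fin d) (Fin d) ℝ).mulVec v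
  refine ⟨fun j => ⌊p j⌋, fun i => ?_⟩
  have h1 := h ((fun j => ((⌊p j⌋ : ℤ) : ℝ)) - p) 1 (fun j => by
    have h2 := Int.floor_le (p j)
    have h3 := Int.lt_floor_add_one (p j)
    simp only [Pi.sub_apply]
    rw [abs_le]
    constructor <;> linarith) i
  rw [Matrix.mulVec_sub, Matrix.mulVec_mulVec, inv_mul_P, Matrix.one_mulVec] at h1
  exact h1

/-- `log |λ_i|` is additive on `ℤ^k`, hence bounded by a multiple of the norm. -/
theorem exists_abs_lam_le :
    ∃ K, 0 ≤ K ∧ ∀ i y, |D.lam i y| ≤ Real.exp (K * latticeNorm y) := by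
  have h : ∀ i, ∃ C, 0 ≤ C ∧ ∀ y, Real.log |D.lam i y| ≤ C * latticeNorm y := fun i =>
    exists_le_mul_latticeNorm (fun y => Real.log |D.lam i y|) (by simp) (fun y z => by
      rw [map_mul, abs_mul, Real.log_mul]
      · exact abs_ne_zero.2 (D.lam_ne_zero i y)
      · exact abs_ne_zero.2 (D.lam_ne_zero i z))
  choose C hC h using h
  refine ⟨∑ i, C i, Finset.sum_nonneg fun i _ => hC i, fun i y => ?_⟩
  rw [← Real.log_le_iff_le_exp (abs_pos.2 (D.lam_ne_zero i y))]
  refine (h i y).trans ?_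
  gcongr
  exact Finset.single_le_sum (fun j _ => hC j) (Finset.mem_univ i)

end Diagonalization

/-! ### The operator `1 - φ(y)`: integrality, fixed vectors and cokernel -/

namespace Diagonalization

variable {d k : ℕ} {φ : Multiplicative (Fin k → ℤ) →* SL(d, ℤ)} (D : Diagonalization φ)

theorem coord_one_sub (y : Multiplicative (Fin k → ℤ)) (x : Fin d → ℤ) (i : Fin d) :
    D.coord ((1 - (φ y : Matrix (Fin d) (Fin d) ℤ)).mulVec x) i =
      (1 - D.lam i y) * D.coord x i := by
  rw [Matrix.sub_mulVec, Matrix.one_mulVec, map_sub, Pi.sub_apply, coord_act]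
  ring

theorem coord_aeval_one_sub (y : Multiplicative (Fin k → ℤ)) (q : Polynomial ℤ) (x : Fin d → ℤ)
    (i : Fin d) :
    D.coord ((Polynomial.aeval (1 - (φ y : Matrix (Fin d) (Fin d) ℤ)) q).mulVec x) i =
      Polynomial.aeval (1 - D.lam i y) q * D.coord x i := by
  have hC : ∀ (n : ℤ) (v : Fin d → ℤ), D.coord ((n • (1 : Matrix (Fin d) (Fin d) ℤ)).mulVec v) i =
      n * D.coord v i := by
    intro n v
    rw [Matrix.smul_mulVec, Matrix.one_mulVec, map_zsmul]
    simp
  induction q using Polynomial.induction_on' generalizing x with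
  | add p q hp hq =>
    rw [map_add, map_add, Matrix.add_mulVec, map_add, Pi.add_apply, hp, hq, add_mul]
  | monomial n a =>
    rw [Polynomial.aeval_monomial, Polynomial.aeval_monomial, Algebra.algebraMap_eq_smul_one,
      ← Matrix.mulVec_mulVec, hC]
    simp only [eq_intCast, mul_assoc]
    congr 1
    induction n generalizing x with
    | zero => simp
    | succ n ih =>
      rw [pow_succ, ← Matrix.mulVec_mulVec, ih, coord_one_sub, pow_succ, mul_assoc]

theorem charpoly_one_sub (y : Multiplicative (Fin k → ℤ)) :
    ((1 - (φ y : Matrix (Fin d) (Fin d) ℤ)).charpoly).map (Int.castRingHom ℝ) =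
      ∏ i, (Polynomial.X - Polynomial.C (1 - D.lam i y)) := by
  rw [← Matrix.charpoly_map]
  have h : (1 - (φ y : Matrix (Fin d) (Fin d) ℤ)).map (Int.castRingHom ℝ) =
      (D.P : Matrix (Fin d) (Fin d) ℝ) * Matrix.diagonal (fun i => 1 - D.lam i y) *
      ((D.P⁻¹ : GL (Fin d) ℝ) : Matrix (Fin d) (Fin d) ℝ) := by
    have h1 : Matrix.diagonal (fun i => 1 - D.lam i y) =
        1 - Matrix.diagonal (fun i => D.lam i y) := by
      rw [← Matrix.diagonal_one, Matrix.diagonal_sub]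
    rw [h1, Matrix.mul_sub, Matrix.sub_mul, Matrix.mul_one, P_mul_inv, ← D.spec]
    ext i j
    simp [Matrix.one_apply]
  rw [h, Matrix.coe_units_inv, Matrix.charpoly_units_conj, Matrix.charpoly_diagonal]

/-- An integer polynomial in `1 - φ y` that projects, up to the integer factor `N`, onto the
fixed space of `φ y`. -/
theorem exists_fixed_projection (y : Multiplicative (Fin k → ℤ)) :
    ∃ N : ℤ, N ≠ 0 ∧
      |(N : ℝ)| = ∏ i with D.lam i y ≠ 1, |1 - D.lam i y| ∧
      ∃ Q H : Matrix (Fin d) (Fin d) ℤ,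
        Q = (1 - (φ y : Matrix (Fin d) (Fin d) ℤ)) * H + N • 1 ∧
        ∀ x i, D.coord (Q.mulVec x) i = if D.lam i y = 1 then N * D.coord x i else 0 := by
  classical
  set M := 1 - (φ y : Matrix (Fin d) (Fin d) ℤ) with hM
  let r : Polynomial ℝ :=
    ∏ i with D.lam i y ≠ 1, (Polynomial.X - Polynomial.C (1 - D.lam i y))
  let e := (Finset.univ.filter fun i => ¬ D.lam i y ≠ 1).card
  have hfac : M.charpoly.map (Int.castRingHom ℝ) = Polynomial.X ^ e * r := by
    rw [hM, D.charpoly_one_sub, ← Finset.prod_filter_mul_prod_filter_not Finset.univ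
      (fun i => D.lam i y ≠ 1), mul_comm]
    congr 1
    rw [Finset.prod_congr rfl (g := fun _ => Polynomial.X), Finset.prod_const]
    intro i hi
    have : D.lam i y = 1 := by simpa using hi
    simp [this]
  -- Divisibility by `X ^ e` is visible on coefficients, so it descends from `ℝ` to `ℤ`. The integer
  -- cofactor `q` has the nonzero `1 - λ_i(y)` as roots; `q(M)` therefore kills those coordinates
  -- and acts as `q(0)` on the fixed ones.
  have hdvd : Polynomial.X ^ e ∣ M.charpoly := by
    rw [Polynomial.X_pow_dvd_iff]
    intro n hn
    have h1 := (Polynomial.X_pow_dvd_iff.1 (Dvd.intro _ hfac.symm)) n hn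
    rw [Polynomial.coeff_map] at h1
    simpa using h1
  obtain ⟨q, hq⟩ := hdvd
  have hqr : q.map (Int.castRingHom ℝ) = r := by
    have h1 := hfac
    rw [hq, Polynomial.map_mul, Polynomial.map_pow, Polynomial.map_X] at h1
    exact mul_left_cancel₀ (pow_ne_zero _ Polynomial.X_ne_zero) h1
  have haeval : ∀ t : ℝ, Polynomial.aeval t q = r.eval t := by
    intro t
    rw [← hqr, Polynomial.eval_map, Polynomial.aeval_def]
    rfl
  have hreval : ∀ t : ℝ, r.eval t = ∏ i with D.lam i y ≠ 1, (t - (1 - D.lam i y)) := by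
    intro t
    simp only [r, Polynomial.eval_prod, Polynomial.eval_sub, Polynomial.eval_X, Polynomial.eval_C]
  have hN : ((q.coeff 0 : ℤ) : ℝ) = r.eval 0 := by
    rw [← Polynomial.coeff_zero_eq_eval_zero, ← hqr, Polynomial.coeff_map]
    rfl
  have habs : |((q.coeff 0 : ℤ) : ℝ)| = ∏ i with D.lam i y ≠ 1, |1 - D.lam i y| := by
    rw [hN, hreval, Finset.abs_prod]
    exact Finset.prod_congr rfl fun i _ => by rw [zero_sub, abs_neg]
  refine ⟨q.coeff 0, ?_, habs, Polynomial.aeval M q, Polynomial.aeval M q.divX, ?_, ?_⟩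
  · intro h0
    rw [h0] at habs
    have : ∏ i with D.lam i y ≠ 1, |1 - D.lam i y| ≠ 0 := by
      refine Finset.prod_ne_zero_iff.2 fun i hi => ?_
      rw [abs_ne_zero, sub_ne_zero]
      exact (Finset.mem_filter.1 hi).2.symm
    simp at habs
    exact this habs.symm
  · conv_lhs => rw [← Polynomial.divX_mul_X_add q]
    rw [map_add, mul_comm, map_mul, Polynomial.aeval_X, Polynomial.aeval_C,
      Algebra.algebraMap_eq_smul_one]
  · intro x i
    rw [D.coord_aeval_one_sub, haeval]
    split_ifs with h
    · rw [h, sub_self, hN]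
    · rw [hreval, Finset.prod_eq_zero (i := i) (by simpa using h) (by simp), zero_mul]

/-- The nonzero numbers `1 - λ_i(y)` are at most exponentially small, and their product is at most
exponentially large. -/
theorem exists_le_abs_one_sub :
    ∃ K, 0 ≤ K ∧ ∀ y,
      (∏ i with D.lam i y ≠ 1, |1 - D.lam i y| ≤ Real.exp (K * (latticeNorm y + 1))) ∧
      ∀ i, D.lam i y ≠ 1 → Real.exp (-(K * (latticeNorm y + 1))) ≤ |1 - D.lam i y| := by
  classical
  obtain ⟨K, hK, h⟩ := D.exists_abs_lam_le
  have hb : ∀ y i, |1 - D.lam i y| ≤ Real.exp ((K + 1) * (latticeNorm y + 1)) := by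
    intro y i
    calc |1 - D.lam i y| ≤ |1| + |D.lam i y| := abs_sub _ _
      _ ≤ Real.exp (K * latticeNorm y) + Real.exp (K * latticeNorm y) := by
        gcongr
        · rw [abs_one]; exact Real.one_le_exp (by positivity)
        · exact h i y
      _ = 2 * Real.exp (K * latticeNorm y) := by ring
      _ ≤ Real.exp 1 * Real.exp (K * latticeNorm y) := by
        gcongr
        linarith [Real.add_one_le_exp 1]
      _ = Real.exp (1 + K * latticeNorm y) := by rw [Real.exp_add]
      _ ≤ _ := by
        apply Real.exp_le_exp.2
        have : (0 : ℝ) ≤ latticeNorm y := Nat.cast_nonneg _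
        nlinarith
  have hprod : ∀ y (s : Finset (Fin d)),
      ∏ i ∈ s, |1 - D.lam i y| ≤ Real.exp (d * (K + 1) * (latticeNorm y + 1)) := by
    intro y s
    calc ∏ i ∈ s, |1 - D.lam i y| ≤ ∏ i ∈ s, Real.exp ((K + 1) * (latticeNorm y + 1)) :=
          Finset.prod_le_prod (fun _ _ => abs_nonneg _) fun i _ => hb y i
      _ = Real.exp (s.card * ((K + 1) * (latticeNorm y + 1))) := by
        rw [Finset.prod_const, ← Real.exp_nat_mul]
      _ ≤ _ := by
        apply Real.exp_le_exp.2
        rw [mul_assoc]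
        gcongr
        simpa using Finset.card_le_univ s
  refine ⟨(d + 1) * (K + 1), by positivity, fun y => ⟨(hprod y _).trans ?_, fun i hi => ?_⟩⟩
  · apply Real.exp_le_exp.2
    gcongr
    linarith
  -- The product of the nonzero factors is `|N| ≥ 1`, so each factor is at least the inverse of the
  -- product of the others.
  · obtain ⟨N, hN, hN', -⟩ := D.exists_fixed_projection y
    have h1 : (1 : ℝ) ≤ |(N : ℝ)| := by
      rw [← Int.cast_abs]
      exact_mod_cast Int.one_le_abs hN
    rw [hN', ← Finset.mul_prod_erase _ _ (a := i) (by simpa using hi)] at h1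
    rw [Real.exp_neg, inv_le_iff_one_le_mul₀ (Real.exp_pos _)]
    refine h1.trans (mul_le_mul_of_nonneg_left ((hprod y _).trans ?_) (abs_nonneg _))
    apply Real.exp_le_exp.2
    gcongr
    linarith

/-- Modulo the image of `1 - φ y`, an integer vector is the sum of a fixed vector and of a
bounded one. -/
theorem exists_split :
    ∃ C, 0 ≤ C ∧ ∀ y (z : Fin d → ℤ), ∃ b r h : Fin d → ℤ,
      z = b + r + (1 - (φ y : Matrix (Fin d) (Fin d) ℤ)).mulVec h ∧
      (∀ i, D.lam i y ≠ 1 → D.coord b i = 0) ∧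
      ∀ i, |D.coord r i| ≤ C * ∏ i with D.lam i y ≠ 1, |1 - D.lam i y| := by
  obtain ⟨C, hC, h⟩ := D.exists_abs_coord_le
  refine ⟨C, hC, fun y z => ?_⟩
  obtain ⟨N, hN, hN', Q, H, hQ, hQc⟩ := D.exists_fixed_projection y
  -- Divide `z` entrywise by `N` with remainder; the multiple of `N` is rewritten with `N • 1 = Q -
  -- (1 - φ y) * H`.
  refine ⟨Q.mulVec (fun j => z j / N), fun j => z j % N, -H.mulVec (fun j => z j / N), ?_, ?_, ?_⟩
  · rw [hQ, Matrix.add_mulVec, Matrix.mulVec_neg, Matrix.mulVec_mulVec, Matrix.smul_mulVec,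
      Matrix.one_mulVec]
    ext j
    simp only [Pi.add_apply, Pi.neg_apply, Pi.smul_apply, smul_eq_mul]
    linarith [Int.emod_add_mul_ediv (z j) N]
  · intro i hi
    rw [hQc, if_neg hi]
  · intro i
    rw [← hN']
    refine h _ _ (fun j => ?_) i
    have h1 := Int.emod_nonneg (z j) hN
    have h2 := Int.emod_lt_abs (z j) hN
    rw [← Int.cast_abs, ← Int.cast_abs, abs_of_nonneg h1]
    exact_mod_cast h2.le

theorem coord_one_sub_eq_zero {y : Multiplicative (Fin k → ℤ)} {i : Fin d} (h : D.lam i y = 1)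
    (x : Fin d → ℤ) : D.coord ((1 - (φ y : Matrix (Fin d) (Fin d) ℤ)).mulVec x) i = 0 := by
  rw [coord_one_sub, h, sub_self, zero_mul]

/-- Fixed vectors of `φ y` approximate the fixed part of an integer vector, uniformly in `y`. -/
theorem exists_fixed_approx :
    ∃ C, 0 ≤ C ∧ ∀ y (z : Fin d → ℤ), ∃ b : Fin d → ℤ,
      (∀ i, D.lam i y ≠ 1 → D.coord b i = 0) ∧
      ∀ i, D.lam i y = 1 → |D.coord z i - D.coord b i| ≤ C := by
  classical
  obtain ⟨C, hC, h⟩ := D.exists_split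
  -- Uniformity in `y`: the conditions on `b` involve `y` only through the set `S` of fixed
  -- coordinates. There are finitely many such sets, and one `y` per set supplies the constant.
  have key : ∀ S : Set (Fin d), ∃ C', ∀ y, {i | D.lam i y = 1} = S → ∀ z : Fin d → ℤ,
      ∃ b : Fin d → ℤ, (∀ i, i ∉ S → D.coord b i = 0) ∧
        ∀ i, i ∈ S → |D.coord z i - D.coord b i| ≤ C' := by
    intro S
    by_cases hS : ∃ y, {i | D.lam i y = 1} = S
    · obtain ⟨y, rfl⟩ := hS
      refine ⟨C * ∏ i with D.lam i y ≠ 1, |1 - D.lam i y|, fun _ _ z => ?_⟩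
      obtain ⟨b, r, a, hz, hb, hr⟩ := h y z
      refine ⟨b, fun i hi => hb i hi, fun i hi => ?_⟩
      have : D.coord z i - D.coord b i = D.coord r i := by
        rw [hz, map_add, map_add, Pi.add_apply, Pi.add_apply, D.coord_one_sub_eq_zero hi]
        ring
      rw [this]
      exact hr i
    · exact ⟨0, fun y hy => (hS ⟨y, hy⟩).elim⟩
  choose B hB using key
  obtain ⟨C', hC'⟩ := Finite.exists_le B
  refine ⟨max C' 0, le_max_right _ _, fun y z => ?_⟩
  obtain ⟨b, hb, hb'⟩ := hB _ y rfl z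
  exact ⟨b, fun i hi => hb i hi, fun i hi => (hb' i hi).trans ((hC' _).trans (le_max_left _ _))⟩

end Diagonalization

/-! ### Word length in the semidirect product -/

section Semidirect

variable {d k : ℕ} {φ : Multiplicative (Fin k → ℤ) →* SL(d, ℤ)}

theorem toAdd_left_mul (g h : LatticeSemidirect φ) :
    (g * h).left.toAdd =
      g.left.toAdd + (φ g.right : Matrix (Fin d) (Fin d) ℤ).mulVec h.left.toAdd := rfl

/-- The translation by `x`, as an element of the semidirect product. -/
def translation (φ : Multiplicative (Fin k → ℤ) →* SL(d, ℤ)) (x : Fin d → ℤ) :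
    LatticeSemidirect φ :=
  SemidirectProduct.inl (Multiplicative.ofAdd x)

theorem translation_add (x x' : Fin d → ℤ) :
    translation φ (x + x') = translation φ x * translation φ x' := by
  unfold translation
  rw [ofAdd_add, map_mul]

theorem translation_mulVec (y : Multiplicative (Fin k → ℤ)) (x : Fin d → ℤ) :
    translation φ ((φ y : Matrix (Fin d) (Fin d) ℤ).mulVec x) =
      SemidirectProduct.inr y * translation φ x * SemidirectProduct.inr y⁻¹ :=
  SemidirectProduct.inl_aut (φ := (slAction d).comp φ) y (Multiplicative.ofAdd x)

variable {X : Set (LatticeSemidirect φ)} (hfin : X.Finite) (hX : Subgroup.closure X = ⊤)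
include hX

theorem exists_wordLength_inr_le :
    ∃ C : ℝ, 0 ≤ C ∧ ∀ y : Multiplicative (Fin k → ℤ),
      (wordLength X (SemidirectProduct.inr y : LatticeSemidirect φ) : ℝ) ≤ C * latticeNorm y :=
  exists_le_mul_latticeNorm
    (fun y => (wordLength X (SemidirectProduct.inr y : LatticeSemidirect φ) : ℝ))
    (by simp [wordLength_one]) (fun y z => by
      rw [map_mul]
      exact_mod_cast wordLength_mul_le hX _ _)

theorem exists_wordLength_translation_le :
    ∃ C : ℝ, 0 ≤ C ∧ ∀ (x : Fin d → ℤ) (R : ℝ), (∀ j, |(x j : ℝ)| ≤ R) →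
      (wordLength X (translation φ x) : ℝ) ≤ C * R := by
  obtain ⟨C, hC, h⟩ := exists_le_mul_latticeNorm (k := d)
    (fun x => (wordLength X (translation φ x.toAdd) : ℝ))
    (by simp [translation, wordLength_one]) (fun y z => by
      rw [toAdd_mul, translation_add]
      exact_mod_cast wordLength_mul_le hX _ _)
  refine ⟨C * d, by positivity, fun x R hx => (h (Multiplicative.ofAdd x)).trans ?_⟩
  rw [mul_assoc]
  gcongr
  unfold latticeNorm
  push_cast
  calc ∑ j, (((x j).natAbs : ℕ) : ℝ) ≤ ∑ _j : Fin d, R := by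
        refine Finset.sum_le_sum fun j _ => ?_
        rw [Nat.cast_natAbs, Int.cast_abs]
        exact hx j
    _ = d * R := by simp

include hfin

theorem exists_latticeNorm_right_le :
    ∃ C : ℝ, 0 ≤ C ∧ ∀ g : LatticeSemidirect φ,
      (latticeNorm g.right : ℝ) ≤ C * wordLength X g :=
  exists_le_mul_wordLength hfin hX (fun g => (latticeNorm g.right : ℝ))
    (by simp [latticeNorm_one]) (fun s => ⟨latticeNorm s.right, fun g => by
      exact_mod_cast latticeNorm_mul_le s.right g.right⟩)

variable (D : Diagonalization φ)

/-- Left multiplication by `s` acts on a coordinate by an affine map, which raises `log (1 + |·|)`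
by a bounded amount. -/
theorem exists_abs_coord_left_le_exp :
    ∃ C : ℝ, 0 ≤ C ∧ ∀ (i : Fin d) (g : LatticeSemidirect φ),
      |D.coord g.left.toAdd i| ≤ Real.exp (C * wordLength X g) := by
  have h : ∀ i, ∃ C, 0 ≤ C ∧ ∀ g : LatticeSemidirect φ,
      Real.log (1 + |D.coord g.left.toAdd i|) ≤ C * wordLength X g := fun i =>
    exists_le_mul_wordLength hfin hX _ (by simp) (fun s =>
      ⟨Real.log (1 + |D.coord s.left.toAdd i| + |D.lam i s.right|), fun g => by
        rw [← Real.log_mul (by positivity) (by positivity)]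
        apply Real.log_le_log (by positivity)
        rw [toAdd_left_mul, map_add, Pi.add_apply, D.coord_act]
        have h1 := abs_add_le (D.coord s.left.toAdd i) (D.lam i s.right * D.coord g.left.toAdd i)
        rw [abs_mul] at h1
        have h2 : 0 ≤ |D.coord s.left.toAdd i| * |D.coord g.left.toAdd i| := by positivity
        nlinarith [abs_nonneg (D.coord g.left.toAdd i), abs_nonneg (D.lam i s.right)]⟩)
  choose C hC h using h
  refine ⟨∑ i, C i, Finset.sum_nonneg fun i _ => hC i, fun i g => ?_⟩
  have h1 : 1 + |D.coord g.left.toAdd i| ≤ Real.exp (C i * wordLength X g) :=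
    (Real.log_le_iff_le_exp (by positivity)).1 (h i g)
  have h2 : Real.exp (C i * wordLength X g) ≤ Real.exp ((∑ i, C i) * wordLength X g) := by
    apply Real.exp_le_exp.2
    gcongr
    exact Finset.single_le_sum (fun j _ => hC j) (Finset.mem_univ i)
  linarith

/-- When `|λ_i|` is identically `1`, these affine maps are isometries, so the coordinate itself
grows by a bounded amount per letter. -/
theorem exists_abs_coord_left_le :
    ∃ C : ℝ, 0 ≤ C ∧ ∀ i : Fin d, (∀ y, |D.lam i y| = 1) → ∀ g : LatticeSemidirect φ,
      |D.coord g.left.toAdd i| ≤ C * wordLength X g := by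
  have h : ∀ i, ∃ C : ℝ, 0 ≤ C ∧ ((∀ y, |D.lam i y| = 1) → ∀ g : LatticeSemidirect φ,
      |D.coord g.left.toAdd i| ≤ C * wordLength X g) := by
    intro i
    by_cases hi : ∀ y, |D.lam i y| = 1
    · obtain ⟨C, hC, h⟩ := exists_le_mul_wordLength hfin hX
        (fun g : LatticeSemidirect φ => |D.coord g.left.toAdd i|) (by simp)
        (fun s => ⟨|D.coord s.left.toAdd i|, fun g => by
          rw [toAdd_left_mul, map_add, Pi.add_apply, D.coord_act]
          refine (abs_add_le _ _).trans_eq ?_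
          rw [abs_mul, hi, one_mul]⟩)
      exact ⟨C, hC, fun _ => h⟩
    · exact ⟨0, le_rfl, fun hi' => (hi hi').elim⟩
  choose C hC h using h
  refine ⟨∑ i, C i, Finset.sum_nonneg fun i _ => hC i, fun i hi g => (h i hi g).trans ?_⟩
  gcongr
  exact Finset.single_le_sum (fun j _ => hC j) (Finset.mem_univ i)

omit hfin

theorem exists_wordLength_translation_le_coord :
    ∃ C : ℝ, 0 ≤ C ∧ ∀ (x : Fin d → ℤ) (R : ℝ), (∀ i, |D.coord x i| ≤ R) →
      (wordLength X (translation φ x) : ℝ) ≤ C * R := by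
  obtain ⟨C, hC, h⟩ := exists_wordLength_translation_le hX
  obtain ⟨C', hC', h'⟩ := D.exists_abs_le_coord
  refine ⟨C * C', by positivity, fun x R hx => ?_⟩
  rw [mul_assoc]
  exact h x _ (h' x R hx)

/-- Vectors in a contracted or expanded eigendirection are exponentially distorted. -/
theorem exists_translation_approx {i : Fin d} (hi : ∃ y, |D.lam i y| ≠ 1) :
    ∃ C R : ℝ, 0 ≤ C ∧ 0 ≤ R ∧ ∀ a : ℝ, ∃ x : Fin d → ℤ,
      (∀ j, |D.coord x j - (Pi.single i a : Fin d → ℝ) j| ≤ R) ∧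
      (wordLength X (translation φ x) : ℝ) ≤ C * (1 + Real.log (1 + |a|)) := by
  obtain ⟨y, hy⟩ : ∃ y, 1 < |D.lam i y| := by
    obtain ⟨y, hy⟩ := hi
    rcases lt_or_gt_of_ne hy with h | h
    · refine ⟨y⁻¹, ?_⟩
      rw [map_inv, abs_inv]
      exact (one_lt_inv₀ (abs_pos.2 (D.lam_ne_zero i y))).2 h
    · exact ⟨y, h⟩
  obtain ⟨C₀, hC₀, hlen⟩ := exists_wordLength_translation_le_coord hX D
  obtain ⟨R, hR, hround⟩ := D.exists_round
  let Λ := ∑ j, |D.lam j y|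
  have hΛ : ∀ j, |D.lam j y| ≤ Λ := fun j =>
    Finset.single_le_sum (f := fun j => |D.lam j y|) (fun _ _ => abs_nonneg _) (Finset.mem_univ j)
  have hΛ0 : 0 ≤ Λ := (abs_nonneg _).trans (hΛ i)
  let t : ℝ := wordLength X (SemidirectProduct.inr y : LatticeSemidirect φ) +
    wordLength X (SemidirectProduct.inr y⁻¹ : LatticeSemidirect φ)
  have ht : 0 ≤ t := by positivity
  let C₁ := C₀ * (R + Λ * R + 1) + t
  have hC₁ : 0 ≤ C₁ := by positivity
  -- Horner's scheme in base `λ_i(y)`: approximate `a / λ_i(y)`, apply `φ(y)` by conjugation, and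
  -- correct the rounding error by a bounded vector `b`. Each digit costs bounded length, and the
  -- error stays at most `R`.
  have key : ∀ (N : ℕ) (a : ℝ), |a| ≤ |D.lam i y| ^ N → ∃ x : Fin d → ℤ,
      (∀ j, |D.coord x j - (Pi.single i a : Fin d → ℝ) j| ≤ R) ∧
      (wordLength X (translation φ x) : ℝ) ≤ C₁ * (N + 1) := by
    intro N
    induction N with
    | zero =>
      intro a ha
      obtain ⟨x, hx⟩ := hround (Pi.single i a)
      refine ⟨x, hx, (hlen x (R + 1) fun j => ?_).trans ?_⟩
      · have h1 : |(Pi.single i a : Fin d → ℝ) j| ≤ 1 := by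
          rcases eq_or_ne j i with rfl | hj
          · simpa using ha
          · simp [Pi.single_eq_of_ne hj]
        have h2 := abs_add_le (D.coord x j - (Pi.single i a : Fin d → ℝ) j)
          ((Pi.single i a : Fin d → ℝ) j)
        rw [sub_add_cancel] at h2
        linarith [hx j]
      · have : 0 ≤ C₀ * (Λ * R) := by positivity
        simp only [C₁, Nat.cast_zero]
        linarith
    | succ N ih =>
      intro a ha
      obtain ⟨x, hx, hxl⟩ := ih (a / D.lam i y) (by
        rw [abs_div, div_le_iff₀ (abs_pos.2 (D.lam_ne_zero i y)), ← pow_succ]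
        exact ha)
      set z := (φ y : Matrix (Fin d) (Fin d) ℤ).mulVec x with hz
      obtain ⟨b, hb⟩ := hround (Pi.single i a - D.coord z)
      refine ⟨b + z, fun j => ?_, ?_⟩
      · have h1 := hb j
        rw [Pi.sub_apply] at h1
        rw [map_add, Pi.add_apply]
        convert h1 using 2
        ring
      · have hbl : ∀ j, |D.coord b j| ≤ R + Λ * R := by
          intro j
          have h1 := hb j
          have h2 : |(Pi.single i a : Fin d → ℝ) j - D.coord z j| ≤ Λ * R := by
            have h3 : (Pi.single i a : Fin d → ℝ) j =
                D.lam j y * (Pi.single i (a / D.lam i y) : Fin d → ℝ) j := by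
              rcases eq_or_ne j i with rfl | hj
              · have := D.lam_ne_zero j y
                simp only [Pi.single_eq_same]
                field_simp
              · simp [Pi.single_eq_of_ne hj]
            rw [h3, hz, D.coord_act, ← mul_sub, abs_mul, abs_sub_comm]
            exact mul_le_mul (hΛ j) (hx j) (abs_nonneg _) hΛ0
          have h3 := abs_add_le (D.coord b j - ((Pi.single i a : Fin d → ℝ) - D.coord z) j)
            (((Pi.single i a : Fin d → ℝ) - D.coord z) j)
          rw [sub_add_cancel] at h3
          exact h3.trans (add_le_add h1 h2)
        have h1 := hlen b _ hbl
        have h2 : (wordLength X (translation φ (b + z)) : ℝ) ≤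
            wordLength X (translation φ b) + (wordLength X (translation φ x) + t) := by
          rw [translation_add, hz, translation_mulVec]
          have e1 := wordLength_mul_le hX (translation φ b)
            (SemidirectProduct.inr y * translation φ x * SemidirectProduct.inr y⁻¹)
          have e2 := wordLength_mul_le hX (SemidirectProduct.inr y * translation φ x)
            (SemidirectProduct.inr y⁻¹)
          have e3 := wordLength_mul_le hX (SemidirectProduct.inr y) (translation φ x)
          simp only [t]
          norm_cast
          omega
        push_cast
        have h3 : C₀ * (R + Λ * R) + t ≤ C₁ := by
          simp only [C₁]
          linarith
        linarith
  have hL : 0 < Real.log |D.lam i y| := Real.log_pos hy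
  refine ⟨C₁ * (2 + 1 / Real.log |D.lam i y|), R, by positivity, hR, fun a => ?_⟩
  have ha : 0 ≤ Real.log (1 + |a|) := Real.log_nonneg (by linarith [abs_nonneg a])
  obtain ⟨x, hx, hxl⟩ := key ⌈Real.log (1 + |a|) / Real.log |D.lam i y|⌉₊ a (by
    have h1 := Nat.le_ceil (Real.log (1 + |a|) / Real.log |D.lam i y|)
    rw [div_le_iff₀ hL, ← Real.log_pow, Real.log_le_log_iff (by positivity) (by positivity)] at h1
    linarith)
  refine ⟨x, hx, hxl.trans ?_⟩
  rw [mul_assoc]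
  gcongr
  have h1 := Nat.ceil_lt_add_one (div_nonneg ha hL.le)
  have h2 : Real.log (1 + |a|) / Real.log |D.lam i y| =
    1 / Real.log |D.lam i y| * Real.log (1 + |a|) := by ring
  have h3 : 0 < 1 / Real.log |D.lam i y| := by positivity
  nlinarith

open Classical in
/-- The contribution of the `i`-th coordinate to the word length of a translation. -/
def coordWeight (i : Fin d) (a : ℝ) : ℝ :=
  if ∀ y, |D.lam i y| = 1 then |a| else Real.log (1 + |a|)

/-- Approximate each eigen-component of `x` by a cheap lattice vector `p i`; what is left has
bounded coordinates. -/
theorem exists_wordLength_translation_le_weight :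
    ∃ C : ℝ, 0 ≤ C ∧ ∀ (x : Fin d → ℤ) (S : ℝ), (∀ i, coordWeight D i (D.coord x i) ≤ S) →
      (wordLength X (translation φ x) : ℝ) ≤ C * (1 + S) := by
  obtain ⟨C₀, hC₀, hlen⟩ := exists_wordLength_translation_le_coord hX D
  obtain ⟨R, hR, hround⟩ := D.exists_round
  have h : ∀ i, ∃ C R : ℝ, 0 ≤ C ∧ 0 ≤ R ∧ ∀ a : ℝ, ∃ x : Fin d → ℤ,
      (∀ j, |D.coord x j - (Pi.single i a : Fin d → ℝ) j| ≤ R) ∧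
      (wordLength X (translation φ x) : ℝ) ≤ C * (1 + coordWeight D i a) := by
    intro i
    by_cases hi : ∀ y, |D.lam i y| = 1
    · refine ⟨C₀ * (R + 1), R, by positivity, hR, fun a => ?_⟩
      obtain ⟨x, hx⟩ := hround (Pi.single i a)
      refine ⟨x, hx, (hlen x (R + |a|) fun j => ?_).trans ?_⟩
      · have h1 : |(Pi.single i a : Fin d → ℝ) j| ≤ |a| := by
          rcases eq_or_ne j i with rfl | hj
          · simp
          · simp [Pi.single_eq_of_ne hj]
        have h2 := abs_add_le (D.coord x j - (Pi.single i a : Fin d → ℝ) j)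
          ((Pi.single i a : Fin d → ℝ) j)
        rw [sub_add_cancel] at h2
        linarith [hx j]
      · rw [coordWeight, if_pos hi, mul_assoc]
        gcongr
        nlinarith [abs_nonneg a]
    · push Not at hi
      obtain ⟨C, R, hC, hR, h⟩ := exists_translation_approx hX D hi
      refine ⟨C, R, hC, hR, fun a => ?_⟩
      rw [coordWeight, if_neg (by push Not; exact hi)]
      exact h a
  choose C R' hC hR' h using h
  refine ⟨C₀ * (∑ i, R' i) + ∑ i, C i, ?_, fun x S hS => ?_⟩
  · have := Finset.sum_nonneg fun i (_ : i ∈ Finset.univ) => hC i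
    have := Finset.sum_nonneg fun i (_ : i ∈ Finset.univ) => hR' i
    positivity
  -- If `d = 0`, nothing forces `S ≥ 0`, but the constant is then zero.
  by_cases hd : Nonempty (Fin d)
  swap
  · rw [not_nonempty_iff] at hd
    have h1 : x = 0 := Subsingleton.elim _ _
    have h2 : translation φ (0 : Fin d → ℤ) = 1 := by simp [translation]
    rw [h1, h2, wordLength_one]
    simp
  have hS0 : 0 ≤ S := by
    refine le_trans ?_ (hS hd.some)
    unfold coordWeight
    split_ifs
    · positivity
    · exact Real.log_nonneg (by linarith [abs_nonneg (D.coord x hd.some)])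
  choose p hp hpl using fun i => h i (D.coord x i)
  have hsum : ∀ s : Finset (Fin d), (wordLength X (translation φ (∑ i ∈ s, p i)) : ℝ) ≤
      ∑ i ∈ s, C i * (1 + S) := by
    intro s
    induction s using Finset.induction_on with
    | empty => simp [translation, wordLength_one]
    | insert a s ha ih =>
      rw [Finset.sum_insert ha, Finset.sum_insert ha, translation_add]
      have h1 : (wordLength X (translation φ (p a) * translation φ (∑ i ∈ s, p i)) : ℝ) ≤
        wordLength X (translation φ (p a)) + wordLength X (translation φ (∑ i ∈ s, p i)) := by
        exact_mod_cast wordLength_mul_le hX _ _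
      have h2 : C a * (1 + coordWeight D a (D.coord x a)) ≤ C a * (1 + S) := by
        have := hC a
        gcongr
        exact hS a
      linarith [hpl a]
  have hrest := hlen (x - ∑ i, p i) (∑ i, R' i) fun j => by
    have h1 : D.coord (x - ∑ i, p i) j =
        ∑ i, ((Pi.single i (D.coord x i) : Fin d → ℝ) j - D.coord (p i) j) := by
      rw [map_sub, map_sum, Pi.sub_apply, Finset.sum_apply, Finset.sum_sub_distrib,
        Finset.sum_pi_single]
      simp
    rw [h1]
    refine (Finset.abs_sum_le_sum_abs _ _).trans (Finset.sum_le_sum fun i _ => ?_)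
    rw [abs_sub_comm]
    exact hp i j
  have h1 : (wordLength X (translation φ x) : ℝ) ≤
      wordLength X (translation φ (x - ∑ i, p i)) + wordLength X (translation φ (∑ i, p i)) := by
    have := wordLength_mul_le hX (translation φ (x - ∑ i, p i)) (translation φ (∑ i, p i))
    rw [← translation_add, sub_add_cancel] at this
    exact_mod_cast this
  have h2 := hsum Finset.univ
  rw [← Finset.sum_mul] at h2
  have h3 : 0 ≤ C₀ * (∑ i, R' i) := by
    have := Finset.sum_nonneg fun i (_ : i ∈ Finset.univ) => hR' i
    positivity
  nlinarith

end Semidirect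

/-! ### A short conjugator with prescribed `ℤ^k`-component -/

section Conjugator

variable {d k : ℕ} {φ : Multiplicative (Fin k → ℤ) →* SL(d, ℤ)}

theorem right_eq_of_conj {u v w : LatticeSemidirect φ} (h : w * u = v * w) : v.right = u.right := by
  have h1 := congrArg SemidirectProduct.right h
  rw [SemidirectProduct.mul_right, SemidirectProduct.mul_right, mul_comm] at h1
  exact (mul_right_cancel h1).symm

theorem left_eq_of_conj {u v w : LatticeSemidirect φ} (h : w * u = v * w) :
    w.left.toAdd + (φ w.right : Matrix (Fin d) (Fin d) ℤ).mulVec u.left.toAdd =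
      v.left.toAdd + (φ u.right : Matrix (Fin d) (Fin d) ℤ).mulVec w.left.toAdd := by
  rw [← right_eq_of_conj h, ← toAdd_left_mul, ← toAdd_left_mul, h]

theorem conj_of_eq {u v w : LatticeSemidirect φ} (hr : v.right = u.right)
    (h : w.left.toAdd + (φ w.right : Matrix (Fin d) (Fin d) ℤ).mulVec u.left.toAdd =
      v.left.toAdd + (φ u.right : Matrix (Fin d) (Fin d) ℤ).mulVec w.left.toAdd) :
    w * u = v * w := by
  apply SemidirectProduct.ext
  · apply Multiplicative.toAdd.injective
    rw [toAdd_left_mul, toAdd_left_mul, h, hr]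
  · rw [SemidirectProduct.mul_right, SemidirectProduct.mul_right, mul_comm, hr]

variable {X : Set (LatticeSemidirect φ)}

/-- If some conjugator has the `ℤ^k`-component `m`, then some conjugator has length linear in `m`
and in the lengths of the two elements. -/
theorem exists_conjugatorLength_le (hfin : X.Finite) (hX : Subgroup.closure X = ⊤)
    (D : Diagonalization φ) :
    ∃ C : ℝ, 0 ≤ C ∧ ∀ u v w : LatticeSemidirect φ, w * u = v * w →
      (conjugatorLength X u v : ℝ) ≤
        C * (1 + (wordLength X u + wordLength X v + latticeNorm w.right)) := by
  obtain ⟨C₁, hC₁, hright⟩ := exists_latticeNorm_right_le hfin hX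
  obtain ⟨K, hK, hlam⟩ := D.exists_abs_lam_le
  obtain ⟨K', hK', hsub⟩ := D.exists_le_abs_one_sub
  obtain ⟨C₃, hC₃, hexp⟩ := exists_abs_coord_left_le_exp hfin hX D
  obtain ⟨C₄, hC₄, hlin⟩ := exists_abs_coord_left_le hfin hX D
  obtain ⟨C₅, hC₅, happ⟩ := D.exists_fixed_approx
  obtain ⟨C₆, hC₆, htrans⟩ := exists_wordLength_translation_le_weight hX D
  obtain ⟨C₇, hC₇, hinr⟩ := exists_wordLength_inr_le hX
  let S₀ := C₅ + C₄ + 2 + K' * (1 + C₁) + C₃ + K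
  have hS₀ : 0 ≤ S₀ := by positivity
  refine ⟨C₆ * (1 + S₀) + C₇, by positivity, fun u v w h => ?_⟩
  obtain ⟨b, hb, hb'⟩ := happ u.right w.left.toAdd
  set n : ℝ := wordLength X u + wordLength X v with hn
  set p : ℝ := ((latticeNorm w.right : ℕ) : ℝ) with hp
  have hu0 : (0 : ℝ) ≤ wordLength X u := Nat.cast_nonneg _
  have hv0 : (0 : ℝ) ≤ wordLength X v := Nat.cast_nonneg _
  have hn0 : 0 ≤ n := by positivity
  have hp0 : 0 ≤ p := Nat.cast_nonneg _
  have hfix : (φ u.right : Matrix (Fin d) (Fin d) ℤ).mulVec b = b := by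
    apply D.coord_injective
    ext i
    rw [D.coord_act]
    by_cases hi : D.lam i u.right = 1
    · rw [hi, one_mul]
    · rw [hb i hi, mul_zero]
  -- Since `φ(y) b = b`, subtracting `b` from the translation part leaves the conjugacy equation
  -- intact.
  have hconj : translation φ (w.left.toAdd - b) * SemidirectProduct.inr w.right * u =
      v * (translation φ (w.left.toAdd - b) * SemidirectProduct.inr w.right) := by
    have hl : (translation φ (w.left.toAdd - b) * SemidirectProduct.inr w.right).left.toAdd =
        w.left.toAdd - b := by
      simp only [translation, SemidirectProduct.mul_left,
        SemidirectProduct.left_inl, SemidirectProduct.left_inr, map_one, mul_one, toAdd_ofAdd]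
    have hr : (translation φ (w.left.toAdd - b) * SemidirectProduct.inr w.right).right =
        w.right := by
      simp only [translation, SemidirectProduct.mul_right, SemidirectProduct.right_inl,
        SemidirectProduct.right_inr, one_mul]
    refine conj_of_eq (right_eq_of_conj h) ?_
    rw [hl, hr, Matrix.mulVec_sub, hfix, sub_add_eq_add_sub, left_eq_of_conj h]
    abel
  have hw : ∀ i, coordWeight D i (D.coord (w.left.toAdd - b) i) ≤ S₀ * (1 + (n + p)) := by
    intro i
    have hlog : ∀ a : ℝ, coordWeight D i a ≤ |a| := by
      intro a
      unfold coordWeight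
      split_ifs
      · exact le_rfl
      · have := Real.log_le_sub_one_of_pos (x := 1 + |a|) (by positivity)
        linarith
    have hnp : 1 ≤ 1 + (n + p) := by linarith
    by_cases hi : D.lam i u.right = 1
    · refine (hlog _).trans ?_
      rw [map_sub, Pi.sub_apply]
      refine (hb' i hi).trans ?_
      have h1 : C₅ ≤ S₀ := by
        have : 0 ≤ K' * (1 + C₁) := by positivity
        simp only [S₀]
        linarith
      nlinarith
    · have hab : D.coord (w.left.toAdd - b) i = D.coord w.left.toAdd i := by
        rw [map_sub, Pi.sub_apply, hb i hi, sub_zero]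
      rw [hab]
      have heq : (1 - D.lam i u.right) * D.coord w.left.toAdd i =
          D.coord v.left.toAdd i - D.lam i w.right * D.coord u.left.toAdd i := by
        have h1 := congrFun (congrArg D.coord (left_eq_of_conj h)) i
        rw [map_add, map_add, Pi.add_apply, Pi.add_apply, D.coord_act, D.coord_act] at h1
        linarith
      have habs : |1 - D.lam i u.right| * |D.coord w.left.toAdd i| ≤
          |D.coord v.left.toAdd i| + |D.lam i w.right| * |D.coord u.left.toAdd i| := by
        rw [← abs_mul, heq, ← abs_mul]
        exact abs_sub _ _
      by_cases hi' : ∀ y, |D.lam i y| = 1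
      · refine (hlog _).trans ?_
        -- The divisor `1 - λ_i(y)` is exactly `2` here, so no exponential loss occurs. This matters
        -- because this direction is undistorted.
        have h1 : D.lam i u.right = -1 := (eq_or_eq_neg_of_abs_eq (hi' _)).resolve_left hi
        rw [h1, hi', show |(1 : ℝ) - -1| = 2 by norm_num] at habs
        have h2 := hlin i hi' u
        have h3 := hlin i hi' v
        have h4 : |D.coord w.left.toAdd i| ≤ C₄ * n := by
          rw [hn, mul_add]
          linarith [abs_nonneg (D.coord w.left.toAdd i)]
        have h5 : C₄ ≤ S₀ := by
          have : 0 ≤ K' * (1 + C₁) := by positivity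
          simp only [S₀]
          linarith
        refine h4.trans (mul_le_mul h5 (by linarith) hn0 hS₀)
      · rw [coordWeight, if_neg hi', Real.log_le_iff_le_exp (by positivity)]
        have h1 := (hsub u.right).2 i hi
        have h2 : |D.coord v.left.toAdd i| ≤ Real.exp (C₃ * n + K * p) := by
          refine (hexp i v).trans (Real.exp_le_exp.2 ?_)
          have : C₃ * wordLength X v ≤ C₃ * n := by gcongr; linarith
          have : 0 ≤ K * p := by positivity
          linarith
        have h3 : |D.lam i w.right| * |D.coord u.left.toAdd i| ≤ Real.exp (C₃ * n + K * p) := by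
          refine (mul_le_mul (hlam i _) (hexp i u) (abs_nonneg _) (Real.exp_pos _).le).trans ?_
          rw [← Real.exp_add]
          apply Real.exp_le_exp.2
          have : C₃ * wordLength X u ≤ C₃ * n := by gcongr; linarith
          linarith
        set L := K' * (latticeNorm u.right + 1) with hL
        have hL' : L ≤ K' * (C₁ * n + 1) := by
          have h4 := hright u
          have : C₁ * wordLength X u ≤ C₁ * n := by gcongr; linarith
          rw [hL]
          gcongr
          linarith
        have hL0 : 0 ≤ L := by positivity
        have h4 : |D.coord w.left.toAdd i| ≤ 2 * Real.exp (L + (C₃ * n + K * p)) := by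
          have h5 : Real.exp (-L) * |D.coord w.left.toAdd i| ≤ 2 * Real.exp (C₃ * n + K * p) := by
            refine (mul_le_mul_of_nonneg_right h1 (abs_nonneg _)).trans ?_
            linarith
          rw [Real.exp_neg, inv_mul_le_iff₀ (Real.exp_pos _)] at h5
          rw [Real.exp_add]
          linarith
        have h5 : 1 ≤ Real.exp (L + (C₃ * n + K * p)) := Real.one_le_exp (by positivity)
        have h6 : (3 : ℝ) ≤ Real.exp 2 := by linarith [Real.add_one_le_exp 2]
        calc 1 + |D.coord w.left.toAdd i| ≤ 3 * Real.exp (L + (C₃ * n + K * p)) := by linarith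
          _ ≤ Real.exp 2 * Real.exp (L + (C₃ * n + K * p)) := by gcongr
          _ = Real.exp (2 + (L + (C₃ * n + K * p))) := by rw [← Real.exp_add]
          _ ≤ _ := by
            apply Real.exp_le_exp.2
            have e1 : 0 ≤ (C₅ + C₄) * (1 + (n + p)) := by positivity
            have e2 : 0 ≤ K' * (n + p) := by positivity
            have e3 : 0 ≤ K' * C₁ * (1 + p) := by positivity
            have e4 : 0 ≤ C₃ * (1 + p) := by positivity
            have e5 : 0 ≤ K * (1 + n) := by positivity
            simp only [S₀]
            nlinarith
  have h1 := htrans _ _ hw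
  have h2 := hinr w.right
  have h3 := conjugatorLength_le (X := X) hconj
  have h4 := wordLength_mul_le hX (translation φ (w.left.toAdd - b))
    (SemidirectProduct.inr w.right)
  have h5 : (conjugatorLength X u v : ℝ) ≤ wordLength X (translation φ (w.left.toAdd - b)) +
      wordLength X (SemidirectProduct.inr w.right : LatticeSemidirect φ) := by
    exact_mod_cast h3.trans h4
  have h6 : 0 ≤ C₆ * (n + p) := by positivity
  have h7 : 0 ≤ C₇ * (1 + n) := by positivity
  nlinarith

end Conjugator

/-! ### The case `k = 1`: a linear bound on the `ℤ`-component -/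

section Cyclic

theorem latticeNorm_fin_one (y : Multiplicative (Fin 1 → ℤ)) :
    latticeNorm y = (y.toAdd 0).natAbs := by
  simp [latticeNorm]

theorem eq_zpow_fin_one (y : Multiplicative (Fin 1 → ℤ)) :
    y = (Multiplicative.ofAdd (fun _ => 1 : Fin 1 → ℤ)) ^ (y.toAdd 0) := by
  apply Multiplicative.toAdd.injective
  ext i
  rw [Subsingleton.elim i 0]
  simp

variable {d : ℕ} {φ : Multiplicative (Fin 1 → ℤ) →* SL(d, ℤ)}

/-- An integer vector that is moved by `φ(2)` is moved away at an exponential rate. -/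
theorem Diagonalization.exists_abs_le_of_orbit (D : Diagonalization φ) :
    ∃ C : ℝ, 0 ≤ C ∧ ∀ (x x' : Fin d → ℤ) (a : ℤ) (R : ℝ),
      (∃ i, D.coord x i ≠ 0 ∧ D.lam i (Multiplicative.ofAdd fun _ => 1) ^ 2 ≠ 1) →
      (∀ i, D.coord x' i = D.lam i (Multiplicative.ofAdd fun _ => 1) ^ a * D.coord x i) →
      (∀ i, |D.coord x i| ≤ Real.exp R) → (∀ i, |D.coord x' i| ≤ Real.exp R) → 0 ≤ R →
      |(a : ℝ)| ≤ C * (1 + R) := by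
  set τ : Multiplicative (Fin 1 → ℤ) := Multiplicative.ofAdd fun _ => 1 with hτ
  obtain ⟨c, hc, hlow⟩ := D.exists_le_abs_coord
  obtain ⟨B, hB⟩ := Finite.exists_le fun i => Real.log |D.lam i τ ^ 2 - 1|
  -- A vanishing logarithm contributes the value `1 / 0 = 0`; such indices are excluded later by
  -- `hℓ0`.
  obtain ⟨E, hE⟩ := Finite.exists_le fun i => 1 / |Real.log (|D.lam i τ|)|
  refine ⟨1 + 2 * max E 0 * (|B| + |Real.log c| + 1), by positivity,
    fun x x' a R hx hxx' hxR hxR' hR => ?_⟩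
  -- The midpoint of the orbit, with the factor `φ(τ²) - 1` removing all coordinates where `λ_i(τ)²
  -- = 1`. It is a nonzero integer vector, so some surviving coordinate is at least `c`.
  set z : Fin d → ℤ :=
    (φ (τ ^ (a / 2)) : Matrix (Fin d) (Fin d) ℤ).mulVec
      ((φ (τ ^ 2) : Matrix (Fin d) (Fin d) ℤ).mulVec x - x) with hz
  have hcz : ∀ i, D.coord z i = D.lam i τ ^ (a / 2) * ((D.lam i τ ^ 2 - 1) * D.coord x i) := by
    intro i
    rw [hz, D.coord_act, map_sub, Pi.sub_apply, D.coord_act, map_zpow, map_pow]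
    ring
  have hz0 : z ≠ 0 := by
    obtain ⟨i, hi, hi'⟩ := hx
    intro h0
    have h1 := hcz i
    rw [h0, map_zero, Pi.zero_apply] at h1
    exact mul_ne_zero (zpow_ne_zero _ (D.lam_ne_zero i τ))
      (mul_ne_zero (sub_ne_zero.2 hi') hi) h1.symm
  obtain ⟨i, hi⟩ := hlow z hz0
  have hl0 := D.lam_ne_zero i τ
  have hne : D.coord z i ≠ 0 := by
    intro h0
    rw [h0, abs_zero] at hi
    linarith
  have hne' : D.lam i τ ^ 2 - 1 ≠ 0 := by
    intro h0
    exact hne (by rw [hcz, h0]; ring)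
  have hxi : D.coord x i ≠ 0 := by
    intro h0
    exact hne (by rw [hcz, h0]; ring)
  set ℓ := Real.log |D.lam i τ| with hℓ
  have hℓ0 : ℓ ≠ 0 := by
    intro h0
    have h1 := Real.eq_one_of_pos_of_log_eq_zero (abs_pos.2 hl0) h0
    apply hne'
    rw [← sq_abs, h1]
    norm_num
  have hlogz : Real.log c ≤
      ((a / 2 : ℤ) : ℝ) * ℓ + (Real.log |D.lam i τ ^ 2 - 1| + Real.log |D.coord x i|) := by
    have h1 := Real.log_le_log hc hi
    rw [hcz, abs_mul, abs_mul, abs_zpow, Real.log_mul (zpow_ne_zero _ (abs_ne_zero.2 hl0))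
      (mul_ne_zero (abs_ne_zero.2 hne') (abs_ne_zero.2 hxi)),
      Real.log_mul (abs_ne_zero.2 hne') (abs_ne_zero.2 hxi), Real.log_zpow] at h1
    exact h1
  have hlogx : Real.log |D.coord x i| ≤ R :=
    (Real.log_le_iff_le_exp (abs_pos.2 hxi)).2 (hxR i)
  have hlogx' : (a : ℝ) * ℓ + Real.log |D.coord x i| ≤ R := by
    have h1 := hxR' i
    rw [hxx', abs_mul, abs_zpow, ← Real.log_le_iff_le_exp (mul_pos
      (zpow_pos (abs_pos.2 hl0) _) (abs_pos.2 hxi)), Real.log_mul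
      (zpow_ne_zero _ (abs_ne_zero.2 hl0)) (abs_ne_zero.2 hxi), Real.log_zpow] at h1
    exact h1
  have hBi := (hB i).trans (le_abs_self B)
  have hcc := neg_abs_le (Real.log c)
  set T := |B| + |Real.log c| + R with hT
  have hT0 : 0 ≤ T := by positivity
  -- Along the orbit the logarithm of this coordinate is affine with slope `ℓ`. It is at most `R` at
  -- both ends and bounded below at the middle; `h1` or `h2` bounds `|a| |ℓ|` according to the sign
  -- of `a ℓ`.
  have h1 : -(((a / 2 : ℤ) : ℝ) * ℓ) ≤ T := by linarith
  have h2 : ((a : ℝ) - ((a / 2 : ℤ) : ℝ)) * ℓ ≤ T := by linarith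
  have h3 : 2 * ((a / 2 : ℤ) : ℝ) ≤ a := by
    have : 2 * (a / 2) ≤ a := by omega
    exact_mod_cast this
  have h4 : (a : ℝ) - 1 ≤ 2 * ((a / 2 : ℤ) : ℝ) := by
    have : a - 1 ≤ 2 * (a / 2) := by omega
    exact_mod_cast this
  have h5 : (|(a : ℝ)| - 1) * |ℓ| ≤ 2 * T := by
    rcases le_total 0 (a : ℝ) with ha | ha <;> rcases le_total 0 ℓ with hp | hp
    · rw [abs_of_nonneg ha, abs_of_nonneg hp]; nlinarith
    · rw [abs_of_nonneg ha, abs_of_nonpos hp]; nlinarith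
    · rw [abs_of_nonpos ha, abs_of_nonneg hp]; nlinarith
    · rw [abs_of_nonpos ha, abs_of_nonpos hp]; nlinarith
  have h6 : |(a : ℝ)| - 1 ≤ 2 * T * max E 0 := by
    have hpos := abs_pos.2 hℓ0
    rw [← le_div_iff₀ hpos] at h5
    refine h5.trans ?_
    rw [div_eq_mul_one_div]
    gcongr
    exact (hE i).trans (le_max_left _ _)
  have hE0 : 0 ≤ max E 0 := le_max_right _ _
  have h7 : T ≤ (|B| + |Real.log c| + 1) * (1 + R) := by
    rw [hT]
    nlinarith [abs_nonneg B, abs_nonneg (Real.log c)]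
  have h8 : T * max E 0 ≤ (|B| + |Real.log c| + 1) * (1 + R) * max E 0 := by gcongr
  linarith

variable {X : Set (LatticeSemidirect φ)}

theorem exists_conj_latticeNorm_le_of_fin_one (hfin : X.Finite) (hX : Subgroup.closure X = ⊤)
    (D : Diagonalization φ) :
    ∃ C : ℝ, 0 ≤ C ∧ ∀ u v : LatticeSemidirect φ, IsConj u v → ∃ w : LatticeSemidirect φ,
      w * u = v * w ∧
      (latticeNorm w.right : ℝ) ≤ C * (1 + (wordLength X u + wordLength X v)) := by
  obtain ⟨C₁, hC₁, hright⟩ := exists_latticeNorm_right_le hfin hX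
  obtain ⟨C₂, hC₂, hexp⟩ := exists_abs_coord_left_le_exp hfin hX D
  obtain ⟨C₃, hC₃, horbit⟩ := D.exists_abs_le_of_orbit
  refine ⟨C₁ + 1 + C₃ * (1 + C₂), by positivity, fun u v huv => ?_⟩
  obtain ⟨w, hw⟩ := isConj_iff.1 huv
  replace hw : w * u = v * w := by rw [← hw]; group
  have hu0 : (0 : ℝ) ≤ wordLength X u := Nat.cast_nonneg _
  have hv0 : (0 : ℝ) ≤ wordLength X v := Nat.cast_nonneg _
  set n : ℝ := wordLength X u + wordLength X v with hn
  have hn0 : 0 ≤ n := by positivity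
  have hCC : 0 ≤ C₃ * (1 + C₂) := by positivity
  by_cases hu : u.right = 1
  · set τ : Multiplicative (Fin 1 → ℤ) := Multiplicative.ofAdd fun _ => 1 with hτ
    set a := w.right.toAdd 0 with ha
    have hwa : w.right = τ ^ a := eq_zpow_fin_one _
    have hx : v.left.toAdd = (φ w.right : Matrix (Fin d) (Fin d) ℤ).mulVec u.left.toAdd := by
      have h1 := left_eq_of_conj hw
      rw [hu, map_one, Matrix.SpecialLinearGroup.coe_one, Matrix.one_mulVec, add_comm] at h1
      exact (add_right_cancel h1).symm
    have hxc : ∀ i, D.coord v.left.toAdd i = D.lam i τ ^ a * D.coord u.left.toAdd i := by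
      intro i
      rw [hx, D.coord_act, hwa, map_zpow]
    have hinr : ∀ b : ℤ,
        (∀ i, D.lam i τ ^ b * D.coord u.left.toAdd i = D.lam i τ ^ a * D.coord u.left.toAdd i) →
        (SemidirectProduct.inr (τ ^ b) : LatticeSemidirect φ) * u =
          v * SemidirectProduct.inr (τ ^ b) := by
      intro b hb
      refine conj_of_eq (right_eq_of_conj hw) ?_
      have h0 : (SemidirectProduct.inr (τ ^ b) : LatticeSemidirect φ).left.toAdd = 0 := rfl
      have h1 : (SemidirectProduct.inr (τ ^ b) : LatticeSemidirect φ).right = τ ^ b := rfl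
      rw [h0, h1, Matrix.mulVec_zero, zero_add, add_zero]
      apply D.coord_injective
      ext i
      rw [D.coord_act, map_zpow, hb, hxc]
    have hnorm : ∀ b : ℤ, latticeNorm
        (SemidirectProduct.inr (τ ^ b) : LatticeSemidirect φ).right = b.natAbs := by
      intro b
      rw [SemidirectProduct.right_inr, latticeNorm_fin_one]
      simp [hτ]
    by_cases hmove : ∃ i, D.coord u.left.toAdd i ≠ 0 ∧ D.lam i τ ^ 2 ≠ 1
    · refine ⟨SemidirectProduct.inr (τ ^ a), hinr a fun _ => rfl, ?_⟩
      rw [hnorm, Nat.cast_natAbs, Int.cast_abs]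
      refine (horbit _ _ a (C₂ * n) hmove hxc (fun i => (hexp i u).trans ?_)
        (fun i => (hexp i v).trans ?_) (by positivity)).trans ?_
      · apply Real.exp_le_exp.2; gcongr; linarith
      · apply Real.exp_le_exp.2; gcongr; linarith
      · have h1 : 1 + C₂ * n ≤ (1 + C₂) * (1 + n) := by nlinarith
        have h2 : C₃ * (1 + C₂ * n) ≤ C₃ * ((1 + C₂) * (1 + n)) := by gcongr
        nlinarith
    · push Not at hmove
      -- `τ²` fixes every nonzero coordinate of `u`, so only the parity of `a` matters.
      refine ⟨SemidirectProduct.inr (τ ^ (a % 2)), hinr _ fun i => ?_, ?_⟩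
      · by_cases h0 : D.coord u.left.toAdd i = 0
        · rw [h0, mul_zero, mul_zero]
        · congr 1
          have h1 := hmove i h0
          conv_rhs => rw [← Int.emod_add_mul_ediv a 2]
          rw [zpow_add₀ (D.lam_ne_zero i τ), zpow_mul]
          have h2 : D.lam i τ ^ (2 : ℤ) = 1 := by exact_mod_cast h1
          rw [h2, one_zpow, mul_one]
      · rw [hnorm]
        have h1 : (a % 2).natAbs ≤ 1 := by omega
        have h2 : (((a % 2).natAbs : ℕ) : ℝ) ≤ 1 := by exact_mod_cast h1
        nlinarith
  · set b := u.right.toAdd 0 with hb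
    have hb0 : b ≠ 0 := by
      intro h0
      apply hu
      rw [eq_zpow_fin_one u.right, ← hb, h0, zpow_zero]
    set t := w.right.toAdd 0 / b with ht
    -- Powers of `u` centralise `u`; this one replaces the `ℤ`-component of `w` by its remainder
    -- modulo that of `u`.
    refine ⟨w * u ^ (-t), ?_, ?_⟩
    · rw [mul_assoc, (Commute.refl u).zpow_left (-t) |>.eq, ← mul_assoc, hw, mul_assoc]
    · have h1 : (w * u ^ (-t)).right = w.right * u.right ^ (-t) := by
        change SemidirectProduct.rightHom (w * u ^ (-t)) = _
        rw [map_mul, map_zpow]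
        rfl
      have h2 : ((w * u ^ (-t)).right.toAdd 0) = w.right.toAdd 0 % b := by
        rw [h1, toAdd_mul, toAdd_zpow, Pi.add_apply, Pi.smul_apply, smul_eq_mul, ← hb]
        linarith [Int.emod_add_mul_ediv (w.right.toAdd 0) b]
      have h3 : latticeNorm (w * u ^ (-t)).right ≤ latticeNorm u.right := by
        rw [latticeNorm_fin_one, latticeNorm_fin_one, h2, ← hb]
        have h4 := Int.emod_nonneg (w.right.toAdd 0) hb0
        have h5 := Int.emod_lt_abs (w.right.toAdd 0) hb0
        rw [Int.abs_eq_natAbs] at h5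
        omega
      have h4 : (latticeNorm (w * u ^ (-t)).right : ℝ) ≤ latticeNorm u.right := by
        exact_mod_cast h3
      have h5 := hright u
      have h6 : C₁ * wordLength X u ≤ C₁ * n := by gcongr; linarith
      nlinarith

end Cyclic

/-! ### The general case: an exponential bound by the pigeonhole principle -/

section Path

variable {k : ℕ}

/-- The lattice points near the segment from `0` to `m`, parametrised by `0 ≤ j ≤ N`. -/
def segmentPath (m : Multiplicative (Fin k → ℤ)) (N j : ℕ) : Multiplicative (Fin k → ℤ) :=
  Multiplicative.ofAdd fun t => (j * m.toAdd t) / N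

/-- The floors are monotone along the segment, so cutting out a piece leaves a number between `0`
and `a`. -/
theorem Int.natAbs_sub_ediv_add_ediv_le (a : ℤ) {N j l : ℕ} (hN : 0 < N) (hjl : j ≤ l)
    (hl : l ≤ N) : (a - (l * a) / N + (j * a) / N).natAbs ≤ a.natAbs := by
  have hN' : (0 : ℤ) < N := by exact_mod_cast hN
  have hjl' : (j : ℤ) ≤ l := by exact_mod_cast hjl
  have hl' : (l : ℤ) ≤ N := by exact_mod_cast hl
  have hj0 : (0 : ℤ) ≤ j := Int.natCast_nonneg j
  have hNa : ((N : ℤ) * a) / N = a := Int.mul_ediv_cancel_left a hN'.ne'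
  rcases le_total 0 a with ha | ha
  · have h1 : ((j : ℤ) * a) / N ≤ (l * a) / N :=
      Int.ediv_le_ediv hN' (mul_le_mul_of_nonneg_right hjl' ha)
    have h2 : ((l : ℤ) * a) / N ≤ (N * a) / N :=
      Int.ediv_le_ediv hN' (mul_le_mul_of_nonneg_right hl' ha)
    have h3 : 0 ≤ ((j : ℤ) * a) / N := Int.ediv_nonneg (mul_nonneg hj0 ha) hN'.le
    omega
  · have h1 : ((l : ℤ) * a) / N ≤ (j * a) / N :=
      Int.ediv_le_ediv hN' (mul_le_mul_of_nonpos_right hjl' ha)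
    have h2 : ((N : ℤ) * a) / N ≤ (l * a) / N :=
      Int.ediv_le_ediv hN' (mul_le_mul_of_nonpos_right hl' ha)
    have h3 : ((j : ℤ) * a) / N ≤ (0 * a) / N :=
      Int.ediv_le_ediv hN' (mul_le_mul_of_nonpos_right hj0 ha)
    rw [zero_mul, Int.zero_ediv] at h3
    omega

theorem Int.natAbs_sub_ediv_add_ediv_lt (a : ℤ) {j l : ℕ} (ha : a ≠ 0) (hjl : j < l)
    (hl : l ≤ a.natAbs) : (a - (l * a) / a.natAbs + (j * a) / a.natAbs).natAbs < a.natAbs := by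
  have h : ∀ i : ℕ, ((i : ℤ) * a) / a.natAbs = i * a.sign := by
    intro i
    rw [Int.natCast_natAbs]
    conv_lhs => rw [← Int.sign_mul_abs a]
    rw [← mul_assoc, abs_mul, abs_abs, Int.abs_sign_of_ne_zero ha, one_mul]
    exact Int.mul_ediv_cancel _ (abs_ne_zero.2 ha)
  rw [h, h]
  rcases lt_or_gt_of_ne ha with h0 | h0
  · rw [Int.sign_eq_neg_one_of_neg h0]
    omega
  · rw [Int.sign_eq_one_of_pos h0]
    omega

/-- With `N = |m_c|` the path moves by exactly one unit per step in direction `c`, so a cut strictly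
shortens that coordinate and lengthens no other. -/
theorem latticeNorm_segmentPath_lt (m : Multiplicative (Fin k → ℤ)) (c : Fin k) {j l : ℕ}
    (hjl : j < l) (hl : l ≤ (m.toAdd c).natAbs) :
    latticeNorm (m * (segmentPath m (m.toAdd c).natAbs l)⁻¹ *
      segmentPath m (m.toAdd c).natAbs j) < latticeNorm m := by
  have hc : m.toAdd c ≠ 0 := by
    intro h0
    rw [h0] at hl
    simp at hl
    omega
  refine Finset.sum_lt_sum (fun t _ => ?_) ⟨c, Finset.mem_univ c, ?_⟩
  · exact Int.natAbs_sub_ediv_add_ediv_le (m.toAdd t) (Int.natAbs_pos.2 hc) hjl.le hl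
  · exact Int.natAbs_sub_ediv_add_ediv_lt (m.toAdd c) hc hjl hl

variable {d : ℕ} {φ : Multiplicative (Fin k → ℤ) →* SL(d, ℤ)}

/-- `log |λ_i|` is linear, so on the segment it is bounded by its values at the ends; rounding to
lattice points costs a factor `exp K`. -/
theorem Diagonalization.exists_abs_lam_segmentPath_le (D : Diagonalization φ) :
    ∃ K : ℝ, 0 ≤ K ∧ ∀ (i : Fin d) (m : Multiplicative (Fin k → ℤ)) (N j : ℕ) (a B : ℝ), 0 < N →
      j ≤ N → |a| ≤ B → |D.lam i m * a| ≤ B →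
      |D.lam i (segmentPath m N j) * a| ≤ Real.exp K * B := by
  obtain ⟨K, hK, hlam⟩ := D.exists_abs_lam_le
  refine ⟨K * k, by positivity, fun i m N j a B hN hj ha hma => ?_⟩
  have hB : 0 ≤ B := (abs_nonneg _).trans ha
  set p := segmentPath m N j with hp
  let e : Multiplicative (Fin k → ℤ) := Multiplicative.ofAdd fun t => -((j * m.toAdd t) % N)
  have hN' : (0 : ℤ) < N := by exact_mod_cast hN
  -- Taking `N`-th powers clears the denominator: `e` collects the remainders, each smaller than
  -- `N`.
  have hpe : p ^ N = m ^ j * e := by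
    apply Multiplicative.toAdd.injective
    ext t
    rw [toAdd_mul, toAdd_pow, toAdd_pow]
    simp only [hp, segmentPath, e, toAdd_ofAdd, Pi.smul_apply, Pi.add_apply, nsmul_eq_mul,
      Pi.mul_apply, Pi.natCast_apply]
    linarith [Int.emod_add_mul_ediv (j * m.toAdd t) N]
  have he : |D.lam i e| ≤ Real.exp (K * k) ^ N := by
    refine (hlam i e).trans ?_
    rw [← Real.exp_nat_mul]
    apply Real.exp_le_exp.2
    have h1 : latticeNorm e ≤ k * N := by
      unfold latticeNorm
      refine (Finset.sum_le_card_nsmul _ _ N fun t _ => ?_).trans (by simp)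
      simp only [e, toAdd_ofAdd]
      have h2 := Int.emod_nonneg (j * m.toAdd t) hN'.ne'
      have h3 := Int.emod_lt_of_pos (j * m.toAdd t) hN'
      omega
    have h2 : (latticeNorm e : ℝ) ≤ k * N := by exact_mod_cast h1
    nlinarith
  refine le_of_pow_le_pow_left₀ hN.ne' (by positivity) ?_
  calc |D.lam i p * a| ^ N = |D.lam i (p ^ N)| * |a| ^ N := by
        rw [abs_mul, mul_pow, map_pow, abs_pow]
    _ = |D.lam i m * a| ^ j * |a| ^ (N - j) * |D.lam i e| := by
        rw [hpe, map_mul, map_pow, abs_mul, abs_pow, abs_mul, mul_pow]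
        conv_lhs => rw [← Nat.add_sub_cancel' hj, pow_add]
        ring
    _ ≤ B ^ j * B ^ (N - j) * Real.exp (K * k) ^ N := by gcongr
    _ = (Real.exp (K * k) * B) ^ N := by
        rw [← pow_add, Nat.add_sub_cancel' hj, mul_pow, mul_comm]

variable {X : Set (LatticeSemidirect φ)}

/-- Two points of the `ℤ^k`-orbit of `u` that agree modulo the image of `1 - φ(y)` shorten a
conjugator. -/
theorem conj_of_segment {u v w : LatticeSemidirect φ} (hw : w * u = v * w)
    (p q : Multiplicative (Fin k → ℤ)) (h : Fin d → ℤ)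
    (hpq : (φ p : Matrix (Fin d) (Fin d) ℤ).mulVec u.left.toAdd =
      (φ q : Matrix (Fin d) (Fin d) ℤ).mulVec u.left.toAdd +
        (1 - (φ u.right : Matrix (Fin d) (Fin d) ℤ)).mulVec h) :
    ∃ w' : LatticeSemidirect φ, w' * u = v * w' ∧ w'.right = w.right * p⁻¹ * q := by
  -- Both `f` and `g` conjugate `u` to `v'`, so `f⁻¹ * g` centralises `u`.
  let v' : LatticeSemidirect φ :=
    ⟨Multiplicative.ofAdd ((φ p : Matrix (Fin d) (Fin d) ℤ).mulVec u.left.toAdd), u.right⟩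
  let g : LatticeSemidirect φ := ⟨Multiplicative.ofAdd h, q⟩
  let f : LatticeSemidirect φ := ⟨1, p⟩
  have hf : f * u = v' * f := by
    refine conj_of_eq rfl ?_
    simp [f, v']
  have hg : g * u = v' * g := by
    refine conj_of_eq rfl ?_
    simp only [g, v', toAdd_ofAdd]
    rw [hpq, Matrix.sub_mulVec, Matrix.one_mulVec]
    abel
  refine ⟨w * f⁻¹ * g, ?_, rfl⟩
  calc w * f⁻¹ * g * u = w * f⁻¹ * (g * u) := by group
    _ = w * f⁻¹ * (v' * f) * f⁻¹ * g := by rw [hg]; group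
    _ = w * u * f⁻¹ * g := by rw [← hf]; group
    _ = v * (w * f⁻¹ * g) := by rw [hw]; group

theorem exists_conj_latticeNorm_le_exp (hfin : X.Finite) (hX : Subgroup.closure X = ⊤)
    (D : Diagonalization φ) :
    ∃ C : ℝ, 0 ≤ C ∧ ∀ u v : LatticeSemidirect φ, IsConj u v → ∃ w : LatticeSemidirect φ,
      w * u = v * w ∧
      (latticeNorm w.right : ℝ) ≤ k * Real.exp (C * (1 + (wordLength X u + wordLength X v))) := by
  obtain ⟨C₁, hC₁, hright⟩ := exists_latticeNorm_right_le hfin hX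
  obtain ⟨C₂, hC₂, hexp⟩ := exists_abs_coord_left_le_exp hfin hX D
  obtain ⟨K, hK, hpath⟩ := D.exists_abs_lam_segmentPath_le
  obtain ⟨K', hK', hsub⟩ := D.exists_le_abs_one_sub
  obtain ⟨C₃, hC₃, hsplit⟩ := D.exists_split
  obtain ⟨C₄, hC₄, hcoord⟩ := D.exists_abs_le_coord
  let A := K + C₂ + K' * (C₁ + 1)
  have hA : 0 ≤ A := by positivity
  let M := 2 * (C₄ * (1 + C₃)) + 1
  have hM : 1 ≤ M := by
    have : 0 ≤ 2 * (C₄ * (1 + C₃)) := by positivity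
    simp only [M]
    linarith
  refine ⟨d * (M + A), by positivity, fun u v huv => ?_⟩
  set n : ℝ := wordLength X u + wordLength X v with hn
  have hu0 : (0 : ℝ) ≤ wordLength X u := Nat.cast_nonneg _
  have hv0 : (0 : ℝ) ≤ wordLength X v := Nat.cast_nonneg _
  have hn0 : 0 ≤ n := by positivity
  -- A conjugator with shortest `ℤ^k`-component; every cut of its segment must then fail.
  obtain ⟨w, hw, hmin⟩ : ∃ w : LatticeSemidirect φ, w * u = v * w ∧
      ∀ w' : LatticeSemidirect φ, w' * u = v * w' → latticeNorm w.right ≤ latticeNorm w'.right := by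
    obtain ⟨w₀, hw₀⟩ := isConj_iff.1 huv
    have hne : {w : LatticeSemidirect φ | w * u = v * w}.Nonempty :=
      ⟨w₀, show w₀ * u = v * w₀ by rw [← hw₀]; group⟩
    let f : LatticeSemidirect φ → ℕ := fun w => latticeNorm w.right
    exact ⟨Function.argminOn f _ hne, Function.argminOn_mem f _ hne,
      fun w' hw' => Function.argminOn_le f {w | w * u = v * w} hw'⟩
  refine ⟨w, hw, ?_⟩
  set m := w.right with hm
  set E := Real.exp (A * (1 + n)) with hE
  have hfixed : ∀ i, D.lam i u.right = 1 →
      D.lam i m * D.coord u.left.toAdd i = D.coord v.left.toAdd i := by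
    intro i hi
    have h1 := congrFun (congrArg D.coord (left_eq_of_conj hw)) i
    rw [map_add, map_add, Pi.add_apply, Pi.add_apply, D.coord_act, D.coord_act, hi] at h1
    linarith
  choose b r h hz hb hr using fun z => hsplit u.right z
  let z : ℕ → ℕ → Fin d → ℤ := fun N j =>
    (φ (segmentPath m N j) : Matrix (Fin d) (Fin d) ℤ).mulVec u.left.toAdd
  -- Representatives of the orbit points modulo the image of `1 - φ(y)`. Their fixed coordinates are
  -- those of the orbit and are controlled by interpolation between `u` and `v`; the others come
  -- from the bounded remainder `r` alone.
  let s : ℕ → ℕ → Fin d → ℤ := fun N j => b (z N j) + r (z N j)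
  have hs : ∀ N j, 0 < N → j ≤ N → ∀ t, |(s N j t : ℝ)| ≤ C₄ * ((1 + C₃) * E) := by
    intro N j hN hj
    refine hcoord _ _ fun i => ?_
    have hE0 : 0 ≤ E := (Real.exp_pos _).le
    by_cases hi : D.lam i u.right = 1
    · have h1 : D.coord (s N j) i =
          D.lam i (segmentPath m N j) * D.coord u.left.toAdd i := by
        rw [← D.coord_act]
        change _ = D.coord (z N j) i
        conv_rhs => rw [hz (z N j), map_add, Pi.add_apply, D.coord_one_sub_eq_zero hi, add_zero]
      have h2 := hpath i m N j (D.coord u.left.toAdd i) (Real.exp (C₂ * n)) hN hj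
        ((hexp i u).trans (Real.exp_le_exp.2 (by gcongr; linarith)))
        (by
          rw [hfixed i hi]
          exact (hexp i v).trans (Real.exp_le_exp.2 (by gcongr; linarith)))
      rw [h1]
      refine h2.trans ?_
      have h3 : Real.exp K * Real.exp (C₂ * n) ≤ E := by
        rw [← Real.exp_add]
        apply Real.exp_le_exp.2
        have e1 : 0 ≤ K * n := by positivity
        have e2 : 0 ≤ K' * (C₁ + 1) * (1 + n) := by positivity
        simp only [A]
        linarith
      nlinarith
    · have h1 : D.coord (s N j) i = D.coord (r (z N j)) i := by
        rw [map_add, Pi.add_apply, hb _ i hi, zero_add]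
      rw [h1]
      refine (hr _ i).trans ?_
      have h2 : ∏ i with D.lam i u.right ≠ 1, |1 - D.lam i u.right| ≤ E := by
        refine (hsub u.right).1.trans (Real.exp_le_exp.2 ?_)
        have h3 := hright u
        have h4 : C₁ * wordLength X u ≤ C₁ * n := by gcongr; linarith
        have h5 : K' * (latticeNorm u.right + 1) ≤ K' * (C₁ * n + 1) := by gcongr; linarith
        have e1 : 0 ≤ (K + C₂) * (1 + n) := by positivity
        have e2 : 0 ≤ K' * C₁ := by positivity
        have e3 : 0 ≤ K' * n := by positivity
        simp only [A]
        nlinarith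
      have h3 : C₃ * ∏ i with D.lam i u.right ≠ 1, |1 - D.lam i u.right| ≤ C₃ * E := by gcongr
      linarith
  have hbound : ∀ c, ((m.toAdd c).natAbs : ℝ) ≤ Real.exp (d * (M + A) * (1 + n)) := by
    intro c
    set N := (m.toAdd c).natAbs with hN
    rcases Nat.eq_zero_or_pos N with h0 | h0
    · rw [h0, Nat.cast_zero]
      positivity
    set T := ⌊C₄ * ((1 + C₃) * E)⌋₊ with hT
    have hTle : (T : ℝ) ≤ C₄ * ((1 + C₃) * E) := Nat.floor_le (by positivity)
    have hmem : ∀ j ∈ Finset.range (N + 1), s N j ∈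
        Finset.Icc (fun _ => -(T : ℤ) : Fin d → ℤ) (fun _ => (T : ℤ)) := by
      intro j hj
      have h1 : ∀ t, |s N j t| ≤ (T : ℤ) := by
        intro t
        have h2 := hs N j h0 (by rw [Finset.mem_range] at hj; omega) t
        rw [Int.abs_eq_natAbs]
        have h3 : (s N j t).natAbs ≤ T := by
          apply Nat.le_floor
          rw [Nat.cast_natAbs, Int.cast_abs]
          exact h2
        exact_mod_cast h3
      rw [Finset.mem_Icc]
      exact ⟨fun t => (abs_le.1 (h1 t)).1, fun t => (abs_le.1 (h1 t)).2⟩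
    have hcard : (Finset.Icc (fun _ => -(T : ℤ) : Fin d → ℤ) (fun _ => (T : ℤ))).card =
        (2 * T + 1) ^ d := by
      rw [Pi.card_Icc, Finset.prod_const, Int.card_Icc, Finset.card_univ, Fintype.card_fin]
      congr 1
      omega
    -- There are `N + 1` path points and `(2 * T + 1) ^ d` lattice points in the box; two equal
    -- representatives would contradict `hmin`.
    have hNle : N ≤ (2 * T + 1) ^ d := by
      by_contra! hlt
      obtain ⟨j, hj, l, hl, hjl, hsj⟩ := Finset.exists_ne_map_eq_of_card_lt_of_maps_to
        (by rw [hcard, Finset.card_range]; omega) hmem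
      rw [Finset.mem_range] at hj hl
      have key : ∀ j l : ℕ, j < l → l ≤ N → s N j = s N l → False := by
        intro j l hjl hl hsj
        obtain ⟨w', hw', hw'r⟩ := conj_of_segment hw (segmentPath m N l) (segmentPath m N j)
          (h (z N l) - h (z N j)) (by
            change z N l = z N j + _
            rw [Matrix.mulVec_sub]
            conv_lhs => rw [hz (z N l)]
            change s N l + _ = _
            rw [← hsj]
            have h1 := hz (z N j)
            change z N j = s N j + _ at h1
            conv_rhs => enter [1]; rw [h1]
            abel)
        have h1 := hmin w' hw'
        rw [hw'r, ← hm] at h1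
        exact absurd (latticeNorm_segmentPath_lt m c hjl hl) (not_lt.2 h1)
      rcases lt_or_gt_of_ne hjl with hlt' | hlt'
      · exact key j l hlt' (by omega) hsj
      · exact key l j hlt' (by omega) hsj.symm
    have hE1 : 1 ≤ E := Real.one_le_exp (by positivity)
    have h1 : (2 * T + 1 : ℝ) ≤ M * E := by
      simp only [M]
      nlinarith
    have h2 : M * E ≤ Real.exp ((M + A) * (1 + n)) := by
      calc M * E ≤ Real.exp M * Real.exp (A * (1 + n)) := by
            gcongr
            linarith [Real.add_one_le_exp M]
        _ = Real.exp (M + A * (1 + n)) := (Real.exp_add _ _).symm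
        _ ≤ _ := by
            apply Real.exp_le_exp.2
            nlinarith
    calc (N : ℝ) ≤ (2 * T + 1 : ℝ) ^ d := by exact_mod_cast hNle
      _ ≤ Real.exp ((M + A) * (1 + n)) ^ d := by
          gcongr
          exact h1.trans h2
      _ = _ := by rw [← Real.exp_nat_mul, mul_assoc]
  unfold latticeNorm
  push_cast
  calc ∑ c, ((m.toAdd c).natAbs : ℝ) ≤ ∑ _c : Fin k, Real.exp (d * (M + A) * (1 + n)) :=
        Finset.sum_le_sum fun c _ => hbound c
    _ = _ := by simp

end Path

end

/-! ### The theorem: combining the two estimates -/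

theorem theorem5p4 (d k : ℕ)
    (φ : Multiplicative (Fin k → ℤ) →* SL(d, ℤ)) (hφ : Function.Injective φ)
    (T : Subgroup SL(d, ℝ)) (hT : IsRealSplitTorus T)
    (hφT : ∀ y, Matrix.SpecialLinearGroup.map (Int.castRingHom ℝ) (φ y) ∈ T)
    (X : Set (LatticeSemidirect φ)) (hfin : X.Finite) (hX : Subgroup.closure X = ⊤) :
    ∃ A B : ℝ, 1 < A ∧ 0 < B ∧
      (k = 1 → ∀ n : ℕ, (conjugacyLength X n : ℝ) ≤ B * n) ∧
      (1 < k → ∀ n : ℕ, (conjugacyLength X n : ℝ) ≤ A ^ n) := by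
  obtain ⟨D⟩ := hT.nonempty_diagonalization hφT
  obtain ⟨C, hC, hconj⟩ := exists_conjugatorLength_le hfin hX D
  by_cases hk : k = 1
  · subst hk
    obtain ⟨C', hC', hbound⟩ := exists_conj_latticeNorm_le_of_fin_one hfin hX D
    refine ⟨2, 2 * (C * (1 + C')) + 1, one_lt_two, by positivity, fun _ n => ?_,
      fun h => (lt_irrefl _ h).elim⟩
    rcases Nat.eq_zero_or_pos n with rfl | hn
    · rw [conjugacyLength_zero hfin hX]
      simp
    obtain ⟨⟨u, v, huv, hc, hlen⟩, -⟩ := isGreatest_conjugacyLength hfin hX n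
    obtain ⟨w, hw, hwn⟩ := hbound u v hc
    have h1 : (wordLength X u + wordLength X v : ℝ) ≤ n := by exact_mod_cast huv
    have h2 : (1 : ℝ) ≤ n := by exact_mod_cast hn
    rw [← hlen]
    calc (conjugatorLength X u v : ℝ)
        ≤ C * (1 + (wordLength X u + wordLength X v + latticeNorm w.right)) := hconj u v w hw
      _ ≤ C * (1 + (n + C' * (1 + n))) := by
        have : C' * (1 + (wordLength X u + wordLength X v : ℝ)) ≤ C' * (1 + n) := by gcongr
        gcongr
        linarith
      _ = C * (1 + C') * (1 + n) := by ring
      _ ≤ C * (1 + C') * (2 * n) := by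
        gcongr
        linarith
      _ ≤ _ := by nlinarith
  · obtain ⟨C', hC', hbound⟩ := exists_conj_latticeNorm_le_exp hfin hX D
    set M := C * (1 + k) with hM
    have hM0 : 0 ≤ M := by positivity
    -- The `+ 1` lets the exponential absorb the linear terms and keeps the base above `1`; the
    -- factor `2` comes from `1 + n ≤ 2 * n` for `n ≥ 1`.
    refine ⟨Real.exp (2 * (M + (C' + 1))), 1, Real.one_lt_exp_iff.2 (by positivity), one_pos,
      fun h => (hk h).elim, fun _ n => ?_⟩
    rcases Nat.eq_zero_or_pos n with rfl | hn
    · rw [conjugacyLength_zero hfin hX]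
      simp
    obtain ⟨⟨u, v, huv, hc, hlen⟩, -⟩ := isGreatest_conjugacyLength hfin hX n
    obtain ⟨w, hw, hwn⟩ := hbound u v hc
    have h1 : (wordLength X u + wordLength X v : ℝ) ≤ n := by exact_mod_cast huv
    have h2 : (1 : ℝ) ≤ n := by exact_mod_cast hn
    rw [← hlen]
    calc (conjugatorLength X u v : ℝ)
        ≤ C * (1 + (wordLength X u + wordLength X v + latticeNorm w.right)) := hconj u v w hw
      _ ≤ C * (Real.exp ((C' + 1) * (1 + n)) + k * Real.exp ((C' + 1) * (1 + n))) := by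
        have h3 : (1 : ℝ) + n ≤ Real.exp ((C' + 1) * (1 + n)) := by
          have := Real.add_one_le_exp ((C' + 1) * (1 + n : ℝ))
          nlinarith
        have h4 : k * Real.exp (C' * (1 + (wordLength X u + wordLength X v))) ≤
            k * Real.exp ((C' + 1) * (1 + n)) := by
          gcongr
          linarith
        refine mul_le_mul_of_nonneg_left ?_ hC
        linarith
      _ = M * Real.exp ((C' + 1) * (1 + n)) := by ring
      _ ≤ Real.exp (M * (1 + n)) * Real.exp ((C' + 1) * (1 + n)) := by
        gcongr
        have := Real.add_one_le_exp (M * (1 + n : ℝ))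
        nlinarith
      _ = Real.exp ((M + (C' + 1)) * (1 + n)) := by
        rw [← Real.exp_add]
        ring_nf
      _ ≤ Real.exp (n * (2 * (M + (C' + 1)))) := by
        apply Real.exp_le_exp.2
        have : 0 ≤ M + (C' + 1) := by positivity
        nlinarith
      _ = _ := Real.exp_nat_mul _ _
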